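/- Let $d\ge 1$, $a\in\{1,-1\}$, and consider the Cauchy problem for the saturated nonlinear Schrödinger equation $$i\partial_t A+\Delta A=-a\,\frac{|A|^2A}{1+|A|^2},\qquad A(\cdot,0)=A_0,$$ for complex-valued functions $A=A(x,t)$, $x\in\mathbb{R}^d$, $t\in\mathbb{R}$, the equation being understood in the sense of distributions. (i) For every $A_0\in L^2(\mathbb{R}^d)$ there is a unique solution $A\in C(\mathbb{R};L^2(\mathbb{R}^d))$. It satisfies $$\int_{\mathbb{R}^d}|A(x,t)|^2\,dx=\int_{\mathbb{R}^d}|A_0(x)|^2\,dx,\qquad t\in\mathbb{R},$$ and it depends continuously on the data: for every $T>0$, the map $A_0\mapsto A$ is continuous from $L^2(\mathbb{R}^d)$ to $C([-T,T];L^2(\mathbb{R}^d))$. (ii) If $A_0\in H^1(\mathbb{R}^d)$, then the solution $A$ of (i) belongs to $C(\mathbb{R};H^1(\mathbb{R}^d))$ and $$\int_{\mathbb{R}^d}\Big[|\nabla A(x,t)|^2+a\ln\big(1+|A(x,t)|^2\big)\Big]dx=\int_{\mathbb{R}^d}\Big[|\nabla A_0(x)|^2+a\ln\big(1+|A_0(x)|^2\big)\Big]dx,\qquad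 t\in\mathbb{R}.$$ -/

import Mathlib

open MeasureTheory
open scoped SchwartzMap LineDeriv Laplacian ENNReal

noncomputable section

namespace SatNLS

/-- The Lebesgue space `L²(ℝᵈ)` of complex-valued functions. -/
abbrev L2 (d : ℕ) : Type := Lp ℂ 2 (volume : Measure (EuclideanSpace ℝ (Fin d)))

/-- The saturated cubic nonlinearity `z ↦ |z|² z / (1 + |z|²)` on the complex plane. -/
def sat (z : ℂ) : ℂ := ((‖z‖ ^ 2 / (1 + ‖z‖ ^ 2) : ℝ) : ℂ) * z

lemma continuous_sat : Continuous sat := by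
  unfold sat
  refine Continuous.mul (Complex.continuous_ofReal.comp ?_) continuous_id
  exact Continuous.div (by fun_prop) (by fun_prop) (fun z => by positivity)

lemma norm_sat_le (z : ℂ) : ‖sat z‖ ≤ ‖z‖ := by
  have h : ‖z‖ ^ 2 / (1 + ‖z‖ ^ 2) ≤ 1 := by
    rw [div_le_one (by positivity)]
    linarith
  have h0 : 0 ≤ ‖z‖ ^ 2 / (1 + ‖z‖ ^ 2) := by positivity
  rw [sat, norm_mul, Complex.norm_real, Real.norm_of_nonneg h0]
  exact mul_le_of_le_one_left (norm_nonneg z) h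

lemma memLp_sat {d : ℕ} (f : L2 d) :
    MemLp (fun x => sat (f x)) 2 (volume : Measure (EuclideanSpace ℝ (Fin d))) :=
  (Lp.memLp f).of_le (continuous_sat.comp_aestronglyMeasurable (Lp.aestronglyMeasurable f))
    (Filter.Eventually.of_forall fun x => norm_sat_le (f x))

/-- The superposition operator `A ↦ |A|² A / (1 + |A|²)` on `L²(ℝᵈ)`. -/
def satL2 {d : ℕ} (f : L2 d) : L2 d := (memLp_sat f).toLp _

/-- The tempered distribution `φ ↦ ∫ φ f` defined by `f ∈ L²(ℝᵈ)`. -/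
abbrev toDist {d : ℕ} (f : L2 d) : 𝓢'(EuclideanSpace ℝ (Fin d), ℂ) :=
  Lp.toTemperedDistribution f

/-- `A ∈ C(ℝ; L²(ℝᵈ))` solves `i ∂ₜA + ΔA = -a |A|² A / (1 + |A|²)` in the sense of
distributions: `t ↦ A t` has, tested against every Schwartz function, a time derivative `dA t`,
and the equation holds at every time between tempered distributions on `ℝᵈ`. -/
def IsSolution {d : ℕ} (a : ℝ) (A : ℝ → L2 d) : Prop :=
  Continuous A ∧
    ∃ dA : ℝ → 𝓢'(EuclideanSpace ℝ (Fin d), ℂ),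
      (∀ t φ, HasDerivAt (fun s => toDist (A s) φ) (dA t φ) t) ∧
      ∀ t, Complex.I • dA t + Δ (toDist (A t)) = -((a : ℂ) • toDist (satL2 (A t)))

/-- The Sobolev space `H¹(ℝᵈ)`, realized as the set of pairs `(f, g)` with `f ∈ L²(ℝᵈ)` and
`g = (g₁, …, g_d)`, `gᵢ ∈ L²(ℝᵈ)`, the distributional gradient of `f` (it is determined by `f`).
The norm inherited from the product, `max (‖f‖, ‖g₁‖, …, ‖g_d‖)`, is equivalent to the
usual `H¹` norm, so the topology is that of `H¹(ℝᵈ)`. -/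
def H1 (d : ℕ) : Submodule ℂ (L2 d × (Fin d → L2 d)) where
  carrier := {u | ∀ i, toDist (u.2 i) = ∂_{(EuclideanSpace.single i (1 : ℝ))} (toDist u.1)}
  add_mem' {u v} hu hv i := by
    have h (f g : L2 d) : toDist (f + g) = toDist f + toDist g :=
      (Lp.toTemperedDistributionCLM ℂ volume 2).map_add f g
    simp only [Prod.fst_add, Prod.snd_add, Pi.add_apply, h, hu i, hv i,
      LineDeriv.lineDerivOp_add]
  zero_mem' i := by
    have h : toDist (0 : L2 d) = 0 := (Lp.toTemperedDistributionCLM ℂ volume 2).map_zero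
    simp [h]
  smul_mem' c u hu i := by
    have h (f : L2 d) : toDist (c • f) = c • toDist f :=
      (Lp.toTemperedDistributionCLM ℂ volume 2).map_smul c f
    simp only [Prod.smul_fst, Prod.smul_snd, Pi.smul_apply, h, hu i,
      LineDeriv.lineDerivOp_smul]

/-- The `L²` function underlying an element of `H¹(ℝᵈ)`. -/
def H1fn {d : ℕ} (u : H1 d) : L2 d := u.1.1

/-- The distributional partial derivatives of an element of `H¹(ℝᵈ)`. -/
def H1grad {d : ℕ} (u : H1 d) : Fin d → L2 d := u.1.2

/-- The energy density `|∇A|² + a ln(1 + |A|²)`. -/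
def energyDensity {d : ℕ} (a : ℝ) (u : H1 d) (x : EuclideanSpace ℝ (Fin d)) : ℝ :=
  (∑ i, ‖H1grad u i x‖ ^ 2) + a * Real.log (1 + ‖H1fn u x‖ ^ 2)

end SatNLS

end

noncomputable section

namespace SatNLS

/-! The nonlinearity is globally Lipschitz on `L²` and the free flow is unitary, so the equation is
an ODE with Lipschitz right-hand side in the interaction picture. On the Fourier side, with ω =
(2π)²|ξ|² and V(t) = e^{itω} 𝓕A(t), it reads V' = `profileField a t V`, and a Picard contraction and
Grönwall give a global flow, uniqueness and Lipschitz dependence. The delicate point is that every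
distributional solution yields a norm-differentiable V (`IsSolution.hasDerivAt_profile`), and
conversely (`isSolution_of_profile`): the weight (1+|ξ|²)⁻² turns ω into a bounded multiplier, and a
derivative known against a separating family upgrades to one in norm once its candidate is
continuous. Mass is conserved because ⟨f, sat f⟩ is real.

For `H¹` data no chain rule is used. The nonlinearity commutes with translations, so Grönwall
applied to a solution and its translate propagates bounds on difference quotients, and these bounds
characterize `H¹`.

The energy is |∇A|² - aΓ(A) + a|A|² with Γ(z) = |z|² - ln(1+|z|²), and f ↦ ∫Γ(f) is differentiable
on all of `L²`. A regularized energy is differentiated exactly. Its rate is bounded uniformly in the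
regularization and tends to 0 (`tendsto_energyRate`), because the commutator terms converge to i
times a real number; dominated convergence in time concludes. Continuity in `H¹` follows from
Lipschitz bounds in time, uniform in the regularization. -/

/-! ### Pointwise bounds for the nonlinearity and its potential -/

lemma norm_sat_sub_le (z w : ℂ) : ‖sat z - sat w‖ ≤ 3 * ‖z - w‖ := by
  set r := ‖z‖ with hr
  set s := ‖w‖ with hs
  have hr0 : 0 ≤ r := norm_nonneg z
  have hs0 : 0 ≤ s := norm_nonneg w
  -- Splitting off the identity leaves u/(1+|u|²); its increment telescopes into two terms, each at
  -- most ‖z - w‖, so the total constant is 3.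
  have key : ∀ u : ℂ, sat u = u - ((1 / (1 + ‖u‖ ^ 2) : ℝ) : ℂ) * u := by
    intro u
    have h : (1 + ‖u‖ ^ 2 : ℝ) ≠ 0 := by positivity
    have h2 : (‖u‖ ^ 2 / (1 + ‖u‖ ^ 2) : ℝ) = 1 - 1 / (1 + ‖u‖ ^ 2) := by field_simp; ring
    rw [sat, h2]; push_cast; ring
  have hsub : sat z - sat w = (z - w) - (((1 / (1 + r ^ 2) : ℝ) : ℂ) * (z - w)
      + (((s ^ 2 - r ^ 2) / ((1 + r ^ 2) * (1 + s ^ 2)) : ℝ) : ℂ) * w) := by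
    have h1 : (1 + r ^ 2 : ℝ) ≠ 0 := by positivity
    have h2 : (1 + s ^ 2 : ℝ) ≠ 0 := by positivity
    have h3 : ((s ^ 2 - r ^ 2) / ((1 + r ^ 2) * (1 + s ^ 2)) : ℝ)
      = 1 / (1 + r ^ 2) - 1 / (1 + s ^ 2) := by field_simp; ring
    rw [key, key, h3]; push_cast; ring
  have hrs : |s - r| ≤ ‖z - w‖ := by
    rw [abs_sub_comm]; exact abs_norm_sub_norm_le z w
  have b1 : ‖((1 / (1 + r ^ 2) : ℝ) : ℂ) * (z - w)‖ ≤ ‖z - w‖ := by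
    rw [norm_mul, Complex.norm_real, Real.norm_of_nonneg (by positivity)]
    refine mul_le_of_le_one_left (norm_nonneg _) ?_
    rw [div_le_one (by positivity)]; nlinarith
  have b2 : ‖(((s ^ 2 - r ^ 2) / ((1 + r ^ 2) * (1 + s ^ 2)) : ℝ) : ℂ) * w‖ ≤ ‖z - w‖ := by
    rw [norm_mul, Complex.norm_real, Real.norm_eq_abs, abs_div,
      abs_of_pos (show 0 < (1 + r ^ 2) * (1 + s ^ 2) by positivity), ← hs,
      show s ^ 2 - r ^ 2 = (s - r) * (s + r) by ring, abs_mul,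
      abs_of_nonneg (show 0 ≤ s + r by positivity), div_mul_eq_mul_div,
      div_le_iff₀ (by positivity)]
    calc |s - r| * (s + r) * s = |s - r| * ((s + r) * s) := by ring
      _ ≤ ‖z - w‖ * ((1 + r ^ 2) * (1 + s ^ 2)) := by
        refine mul_le_mul hrs ?_ (by positivity) (norm_nonneg _)
        nlinarith [sq_nonneg (1 - r * s), sq_nonneg r, sq_nonneg s]
  rw [hsub]
  calc _ ≤ ‖z - w‖ + (‖z - w‖ + ‖z - w‖) :=
        (norm_sub_le _ _).trans (add_le_add le_rfl ((norm_add_le _ _).trans (add_le_add b1 b2)))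
    _ = 3 * ‖z - w‖ := by ring

/-- The potential `Γ(z) = |z|² - ln(1 + |z|²)`, whose real gradient is `2 sat`. -/
def potential (z : ℂ) : ℝ := ‖z‖ ^ 2 - Real.log (1 + ‖z‖ ^ 2)

lemma log_one_add_le (x : ℝ) (hx : 0 ≤ x) : Real.log (1 + x) ≤ x := by
  have := Real.log_le_sub_one_of_pos (show 0 < 1 + x by linarith)
  linarith

lemma continuous_log_one_add_sq : Continuous fun z : ℂ => Real.log (1 + ‖z‖ ^ 2) :=
  Continuous.log (by fun_prop) fun z => by positivity

/-- With x = |z|², y = |w|², e = |w - z|², the remainder is (y-x)/(1+x) - ln((1+y)/(1+x)) plus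
x/(1+x)·e. By 1 - 1/q ≤ ln q ≤ q - 1 the first part lies between 0 and (y-x)²/((1+x)(1+y)) ≤ 2e. The
bound is globally quadratic, so it survives integration over `L²`. -/
lemma abs_potential_sub_le (z w : ℂ) :
    |potential w - potential z - 2 * (inner ℂ (sat z) (w - z)).re| ≤ 3 * ‖w - z‖ ^ 2 := by
  set x := ‖z‖ ^ 2 with hx
  set y := ‖w‖ ^ 2 with hy
  set e := ‖w - z‖ ^ 2 with he
  have hx0 : 0 ≤ x := by positivity
  have hy0 : 0 ≤ y := by positivity
  have he0 : 0 ≤ e := by positivity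
  have hin : 2 * (inner ℂ z (w - z)).re = y - x - e := by
    have h := @norm_add_sq ℂ ℂ _ _ _ z (w - z)
    rw [add_sub_cancel] at h
    simp only [RCLike.re_to_complex] at h
    linarith
  have hsat : (inner ℂ (sat z) (w - z)).re = x / (1 + x) * (inner ℂ z (w - z)).re := by
    rw [sat, ← smul_eq_mul, inner_smul_left, Complex.conj_ofReal, Complex.re_ofReal_mul]
  have h1x : 0 < 1 + x := by linarith
  have h1y : 0 < 1 + y := by linarith
  have hlog : Real.log (1 + y) - Real.log (1 + x) = Real.log ((1 + y) / (1 + x)) :=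
    (Real.log_div h1y.ne' h1x.ne').symm
  have hq : 0 < (1 + y) / (1 + x) := by positivity
  have hup := Real.log_le_sub_one_of_pos hq
  have hlo := Real.one_sub_inv_le_log_of_pos hq
  rw [inv_div] at hlo
  have hdiff : (y - x) ^ 2 ≤ 2 * e * ((1 + x) * (1 + y)) := by
    have h1 : |‖w‖ - ‖z‖| ≤ ‖w - z‖ := abs_norm_sub_norm_le w z
    have h2 : (‖w‖ - ‖z‖) ^ 2 ≤ e := by
      rw [he, ← sq_abs]; exact pow_le_pow_left₀ (abs_nonneg _) h1 2
    have h3 : (y - x) ^ 2 = (‖w‖ - ‖z‖) ^ 2 * (‖w‖ + ‖z‖) ^ 2 := by rw [hx, hy]; ring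
    have h4 : (‖w‖ + ‖z‖) ^ 2 ≤ 2 * ((1 + x) * (1 + y)) := by
      nlinarith [sq_nonneg (‖w‖ - ‖z‖), mul_nonneg hx0 hy0]
    rw [h3]
    calc _ ≤ e * (2 * ((1 + x) * (1 + y))) := mul_le_mul h2 h4 (by positivity) he0
      _ = _ := by ring
  have hrem : (y - x) ^ 2 / ((1 + x) * (1 + y)) ≤ 2 * e := by
    rw [div_le_iff₀ (by positivity)]; exact hdiff
  have hθ0 : 0 ≤ x / (1 + x) := by positivity
  have hθ1 : x / (1 + x) ≤ 1 := by rw [div_le_one h1x]; linarith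
  have hexp : potential w - potential z - 2 * (inner ℂ (sat z) (w - z)).re
      = ((y - x) / (1 + x) - Real.log ((1 + y) / (1 + x))) + x / (1 + x) * e := by
    have : 2 * (inner ℂ (sat z) (w - z)).re = x / (1 + x) * (y - x - e) := by
      rw [hsat, ← hin]; ring
    rw [this, potential, potential, ← hx, ← hy, ← hlog]
    field_simp; ring
  have e1 : (1 + y) / (1 + x) - 1 = (y - x) / (1 + x) := by field_simp; ring
  have e2 : (y - x) / (1 + x) - (1 - (1 + x) / (1 + y)) = (y - x) ^ 2 / ((1 + x) * (1 + y)) := by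
    field_simp; ring
  rw [hexp, abs_of_nonneg (by rw [e1] at hup; nlinarith [mul_nonneg hθ0 he0])]
  nlinarith [mul_le_mul_of_nonneg_right hθ1 he0]

/-! ### The superposition operator and the potential energy on `L²` -/

variable {d : ℕ}

lemma coeFn_satL2 (f : L2 d) : satL2 f =ᵐ[volume] fun x => sat (f x) :=
  (memLp_sat f).coeFn_toLp

lemma satL2_zero : satL2 (0 : L2 d) = 0 := by
  refine Lp.ext ?_
  filter_upwards [coeFn_satL2 (0 : L2 d), Lp.coeFn_zero ℂ 2 (volume : Measure (EuclideanSpace ℝ (Fin d)))] with x h1 h2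
  rw [h1, h2]; simp [sat]

lemma norm_satL2_sub_le (f g : L2 d) : ‖satL2 f - satL2 g‖ ≤ 3 * ‖f - g‖ := by
  refine Lp.norm_le_mul_norm_of_ae_le_mul ?_
  filter_upwards [coeFn_satL2 f, coeFn_satL2 g, Lp.coeFn_sub f g,
    Lp.coeFn_sub (satL2 f) (satL2 g)] with x h1 h2 h3 h4
  rw [h3, h4, Pi.sub_apply, Pi.sub_apply, h1, h2]
  exact norm_sat_sub_le _ _

lemma norm_satL2_le (f : L2 d) : ‖satL2 f‖ ≤ ‖f‖ := by
  refine Lp.norm_le_norm_of_ae_le ?_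
  filter_upwards [coeFn_satL2 f] with x h1
  rw [h1]
  exact norm_sat_le _

lemma lipschitz_satL2 : LipschitzWith 3 (satL2 : L2 d → L2 d) :=
  LipschitzWith.of_dist_le_mul fun f g => by
    simpa [dist_eq_norm] using norm_satL2_sub_le f g

lemma continuous_satL2 : Continuous (satL2 : L2 d → L2 d) := lipschitz_satL2.continuous

/-- The nonlinearity multiplies f by a real function; this gauge invariance is the source of mass
conservation. -/
lemma im_inner_satL2 (f : L2 d) : (inner ℂ f (satL2 f)).im = 0 := by
  have h : inner ℂ f (satL2 f)
      = ((∫ x, ‖f x‖ ^ 2 / (1 + ‖f x‖ ^ 2) * ‖f x‖ ^ 2 : ℝ) : ℂ) := by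
    rw [L2.inner_def, ← integral_complex_ofReal]
    refine integral_congr_ae ?_
    filter_upwards [coeFn_satL2 f] with x hx
    rw [hx, sat, ← smul_eq_mul, inner_smul_right, inner_self_eq_norm_sq_to_K]
    push_cast
    rfl
  rw [h, Complex.ofReal_im]

lemma integrable_norm_sq (f : L2 d) : Integrable fun x => ‖f x‖ ^ 2 :=
  (memLp_two_iff_integrable_sq_norm (Lp.aestronglyMeasurable f)).1 (Lp.memLp f)

lemma norm_sq_eq_integral {α : Type*} [MeasurableSpace α] {μ : Measure α} (f : Lp ℂ 2 μ) :
    ‖f‖ ^ 2 = ∫ x, ‖f x‖ ^ 2 ∂μ := by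
  rw [@norm_sq_eq_re_inner ℂ, L2.inner_def, ← integral_re (L2.integrable_inner f f)]
  refine integral_congr_ae (Filter.Eventually.of_forall fun x => ?_)
  simp only [← norm_sq_eq_re_inner]

lemma integrable_log (f : L2 d) : Integrable fun x => Real.log (1 + ‖f x‖ ^ 2) := by
  refine (integrable_norm_sq f).mono'
    (continuous_log_one_add_sq.comp_aestronglyMeasurable (Lp.aestronglyMeasurable f))
    (Filter.Eventually.of_forall fun x => ?_)
  rw [Real.norm_of_nonneg (Real.log_nonneg (by nlinarith [norm_nonneg (f x)]))]
  exact log_one_add_le _ (by positivity)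

lemma integrable_potential (f : L2 d) : Integrable fun x => potential (f x) :=
  (integrable_norm_sq f).sub (integrable_log f)

/-- The functional `f ↦ ∫ Γ(f)` on `L²`. -/
def potentialEnergy (f : L2 d) : ℝ := ∫ x, potential (f x)

lemma potentialEnergy_eq (f : L2 d) :
    potentialEnergy f = ‖f‖ ^ 2 - ∫ x, Real.log (1 + ‖f x‖ ^ 2) := by
  rw [norm_sq_eq_integral, ← integral_sub (integrable_norm_sq f) (integrable_log f)]; rfl

lemma abs_potentialEnergy_sub_le (f g : L2 d) :
    |potentialEnergy g - potentialEnergy f - 2 * (inner ℂ (satL2 f) (g - f)).re|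
      ≤ 3 * ‖g - f‖ ^ 2 := by
  have h1 : (inner ℂ (satL2 f) (g - f)).re = ∫ x, (inner ℂ (satL2 f x) ((g - f) x)).re := by
    rw [L2.inner_def]; exact (integral_re (L2.integrable_inner (𝕜 := ℂ) (satL2 f) (g - f))).symm
  have hi : Integrable fun x => (inner ℂ (satL2 f x) ((g - f) x)).re :=
    (L2.integrable_inner (𝕜 := ℂ) (satL2 f) (g - f)).re
  have hp : Integrable fun x => potential (g x) - potential (f x) :=
    (integrable_potential g).sub (integrable_potential f)
  rw [h1, potentialEnergy, potentialEnergy,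
    ← integral_sub (integrable_potential g) (integrable_potential f), ← integral_const_mul,
    ← integral_sub hp (hi.const_mul 2),
    norm_sq_eq_integral, ← integral_const_mul]
  refine (abs_integral_le_integral_abs).trans (integral_mono_ae ?_ ?_ ?_)
  · exact (hp.sub (hi.const_mul 2)).abs
  · exact (integrable_norm_sq (g - f)).const_mul 3
  · filter_upwards [coeFn_satL2 f, Lp.coeFn_sub g f] with x h2 h3
    simp only [h2, h3, Pi.sub_apply]
    exact abs_potential_sub_le _ _

/-- The quadratic remainder makes `potentialEnergy` Fréchet differentiable over ℝ on all of `L²`;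
the claim is then the chain rule. -/
lemma hasDerivAt_potentialEnergy {f : ℝ → L2 d} {f' : L2 d} {t : ℝ} (hf : HasDerivAt f f' t) :
    HasDerivAt (fun s => potentialEnergy (f s)) (2 * (inner ℂ (satL2 (f t)) f').re) t := by
  have hF : HasFDerivAt potentialEnergy
      ((2 : ℝ) • (Complex.reCLM ∘L ((innerSL ℂ (satL2 (f t))).restrictScalars ℝ))) (f t) := by
    refine .of_isLittleO ?_
    have : (fun g => ‖g - f t‖ ^ 2) =o[nhds (f t)] fun g => g - f t := by
      refine Asymptotics.isLittleO_norm_right.1 ?_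
      have := (Asymptotics.isLittleO_pow_id (𝕜 := ℝ) one_lt_two).comp_tendsto
        (show Filter.Tendsto (fun g => ‖g - f t‖) (nhds (f t)) (nhds 0) from
          (by fun_prop : Continuous fun g => ‖g - f t‖).tendsto' _ _ (by simp))
      exact this
    refine Asymptotics.IsBigO.trans_isLittleO (Asymptotics.IsBigO.of_bound 3 ?_) this
    refine Filter.Eventually.of_forall fun g => ?_
    simpa using abs_potentialEnergy_sub_le (f t) g
  have h := hF.comp_hasDerivAt t hf
  exact h

lemma continuous_potentialEnergy : Continuous (potentialEnergy (d := d)) := by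
  refine continuous_iff_continuousAt.2 fun f => ?_
  have h0 : Filter.Tendsto (fun g : L2 d => 2 * (inner ℂ (satL2 f) (g - f)).re) (nhds f) (nhds 0) := by
    have : Continuous fun g : L2 d => 2 * (inner ℂ (satL2 f) (g - f)).re :=
      continuous_const.mul (Complex.continuous_re.comp
        (continuous_const.inner (continuous_id.sub continuous_const)))
    exact this.tendsto' _ _ (by simp)
  have h1 : Filter.Tendsto (fun g : L2 d => 3 * ‖g - f‖ ^ 2) (nhds f) (nhds 0) :=
    (by fun_prop : Continuous fun g : L2 d => 3 * ‖g - f‖ ^ 2).tendsto' _ _ (by simp)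
  have h2 := (squeeze_zero_norm (fun g => abs_potentialEnergy_sub_le f g) h1).add h0
  simp only [sub_add_cancel, add_zero] at h2
  exact tendsto_sub_nhds_zero_iff.1 h2

/-! ### Multiplication operators on `L²` -/

section Multiplier

variable {α : Type*} [MeasurableSpace α] {μ : Measure α}

/-- Bounded measurable functions. -/
def BddMeas (m : α → ℂ) : Prop := Measurable m ∧ ∃ C : ℝ, ∀ x, ‖m x‖ ≤ C

lemma BddMeas.mul {m n : α → ℂ} (hm : BddMeas m) (hn : BddMeas n) :
    BddMeas fun x => m x * n x := by
  obtain ⟨hm, C, hC⟩ := hm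
  obtain ⟨hn, D, hD⟩ := hn
  refine ⟨hm.mul hn, C * D, fun x => ?_⟩
  rw [norm_mul]
  exact mul_le_mul (hC x) (hD x) (norm_nonneg _) ((norm_nonneg _).trans (hC x))

lemma BddMeas.sub {m n : α → ℂ} (hm : BddMeas m) (hn : BddMeas n) :
    BddMeas fun x => m x - n x := by
  obtain ⟨hm, C, hC⟩ := hm
  obtain ⟨hn, D, hD⟩ := hn
  exact ⟨hm.sub hn, C + D, fun x => (norm_sub_le _ _).trans (add_le_add (hC x) (hD x))⟩

lemma BddMeas.const (c : ℂ) : BddMeas fun _ : α => c :=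
  ⟨measurable_const, ‖c‖, fun _ => le_rfl⟩

lemma BddMeas.const_mul {m : α → ℂ} (hm : BddMeas m) (c : ℂ) : BddMeas fun x => c * m x :=
  (BddMeas.const c).mul hm

lemma BddMeas.conj {m : α → ℂ} (hm : BddMeas m) :
    BddMeas fun x => (starRingEnd ℂ) (m x) := by
  obtain ⟨hm, C, hC⟩ := hm
  exact ⟨Complex.continuous_conj.measurable.comp hm, C, fun x => by simpa using hC x⟩

lemma BddMeas.memLp_mul {m : α → ℂ} (hm : BddMeas m) (f : Lp ℂ 2 μ) :
    MemLp (fun x => m x * f x) 2 μ := by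
  obtain ⟨hm, C, hC⟩ := hm
  refine (Lp.memLp f).of_le_mul (c := C) (hm.aestronglyMeasurable.mul (Lp.aestronglyMeasurable f))
    (Filter.Eventually.of_forall fun x => ?_)
  rw [norm_mul]
  exact mul_le_mul_of_nonneg_right (hC x) (norm_nonneg _)

lemma BddMeas.ae_toLp {m : α → ℂ} (hm : BddMeas m) (f : Lp ℂ 2 μ) :
    (hm.memLp_mul f).toLp _ =ᵐ[μ] fun x => m x * f x :=
  (hm.memLp_mul f).coeFn_toLp

open Classical in
/-- Multiplication by a bounded measurable function on `L²` (zero if `m` is not such). -/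
def mulOp (m : α → ℂ) : Lp ℂ 2 μ →L[ℂ] Lp ℂ 2 μ :=
  if hm : BddMeas m then
    LinearMap.mkContinuousOfExistsBound
      { toFun := fun f => (hm.memLp_mul f).toLp _
        map_add' := fun f g => by
          refine Lp.ext ?_
          filter_upwards [hm.ae_toLp (f + g), hm.ae_toLp f, hm.ae_toLp g, Lp.coeFn_add f g,
            Lp.coeFn_add ((hm.memLp_mul f).toLp _) ((hm.memLp_mul g).toLp _)] with x h1 h2 h3 h4 h5
          rw [h5, h1, h4, Pi.add_apply, Pi.add_apply, h2, h3, mul_add]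
        map_smul' := fun c f => by
          refine Lp.ext ?_
          filter_upwards [hm.ae_toLp (c • f), hm.ae_toLp f, Lp.coeFn_smul c f,
            Lp.coeFn_smul c ((hm.memLp_mul f).toLp _)] with x h1 h2 h3 h4
          rw [RingHom.id_apply, h4, h1, h3, Pi.smul_apply, Pi.smul_apply, h2, smul_eq_mul,
            smul_eq_mul, mul_left_comm] }
      (by
        obtain ⟨C, hC⟩ := hm.2
        refine ⟨C, fun f => Lp.norm_le_mul_norm_of_ae_le_mul ?_⟩
        filter_upwards [hm.ae_toLp f] with x hx
        change ‖(hm.memLp_mul f).toLp _ x‖ ≤ _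
        rw [hx, norm_mul]
        exact mul_le_mul_of_nonneg_right (hC x) (norm_nonneg _))
  else 0

lemma mulOp_ae {m : α → ℂ} (hm : BddMeas m) (f : Lp ℂ 2 μ) :
    mulOp m f =ᵐ[μ] fun x => m x * f x := by
  rw [mulOp, dif_pos hm]
  exact hm.ae_toLp f

lemma mulOp_eq_iff {m : α → ℂ} (hm : BddMeas m) (f g : Lp ℂ 2 μ) :
    mulOp m f = g ↔ g =ᵐ[μ] fun x => m x * f x :=
  ⟨fun h => h ▸ mulOp_ae hm f, fun h => Lp.ext ((mulOp_ae hm f).trans h.symm)⟩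

lemma norm_mulOp_apply_le {m : α → ℂ} (hm : Measurable m) {C : ℝ} (hC : ∀ x, ‖m x‖ ≤ C)
    (f : Lp ℂ 2 μ) : ‖mulOp m f‖ ≤ C * ‖f‖ := by
  refine Lp.norm_le_mul_norm_of_ae_le_mul ?_
  filter_upwards [mulOp_ae ⟨hm, C, hC⟩ f] with x hx
  rw [hx, norm_mul]
  exact mul_le_mul_of_nonneg_right (hC x) (norm_nonneg _)

lemma norm_mulOp_le {m : α → ℂ} (hm : Measurable m) {C : ℝ} (hC0 : 0 ≤ C)
    (hC : ∀ x, ‖m x‖ ≤ C) : ‖(mulOp m : Lp ℂ 2 μ →L[ℂ] Lp ℂ 2 μ)‖ ≤ C :=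
  ContinuousLinearMap.opNorm_le_bound _ hC0 (norm_mulOp_apply_le hm hC)

lemma norm_mulOp_eq {m : α → ℂ} (hm : Measurable m) (hC : ∀ x, ‖m x‖ = 1)
    (f : Lp ℂ 2 μ) : ‖mulOp m f‖ = ‖f‖ := by
  have h := mulOp_ae ⟨hm, 1, fun x => (hC x).le⟩ f
  refine le_antisymm (Lp.norm_le_norm_of_ae_le ?_) (Lp.norm_le_norm_of_ae_le ?_)
  all_goals
    filter_upwards [h] with x hx
    rw [hx, norm_mul, hC, one_mul]

lemma mulOp_mulOp {m n : α → ℂ} (hm : BddMeas m) (hn : BddMeas n) (f : Lp ℂ 2 μ) :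
    mulOp m (mulOp n f) = mulOp (fun x => m x * n x) f := by
  rw [mulOp_eq_iff hm]
  filter_upwards [mulOp_ae hn f, mulOp_ae (hm.mul hn) f] with x h1 h2
  rw [h1, h2, mul_assoc]

lemma mulOp_comm {m n : α → ℂ} (hm : BddMeas m) (hn : BddMeas n) (f : Lp ℂ 2 μ) :
    mulOp m (mulOp n f) = mulOp n (mulOp m f) := by
  rw [mulOp_mulOp hm hn, mulOp_mulOp hn hm]
  simp only [mul_comm]

lemma mulOp_one (f : Lp ℂ 2 μ) : mulOp (fun _ => 1) f = f := by
  rw [mulOp_eq_iff (BddMeas.const 1)]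
  simp

lemma mulOp_sub {m n : α → ℂ} (hm : BddMeas m) (hn : BddMeas n) :
    (mulOp (fun x => m x - n x) : Lp ℂ 2 μ →L[ℂ] Lp ℂ 2 μ) = mulOp m - mulOp n := by
  ext1 f
  rw [mulOp_eq_iff (hm.sub hn), _root_.sub_apply]
  filter_upwards [mulOp_ae hn f, mulOp_ae hm f, Lp.coeFn_sub (mulOp m f) (mulOp n f)]
    with x h1 h2 h3
  rw [h3, Pi.sub_apply, h1, h2, sub_mul]

lemma mulOp_const_mul {m : α → ℂ} (hm : BddMeas m) (c : ℂ) :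
    (mulOp (fun x => c * m x) : Lp ℂ 2 μ →L[ℂ] Lp ℂ 2 μ) = c • mulOp m := by
  ext1 f
  rw [mulOp_eq_iff (hm.const_mul c), _root_.smul_apply]
  filter_upwards [mulOp_ae hm f, Lp.coeFn_smul c (mulOp m f)] with x h1 h2
  rw [h2, Pi.smul_apply, h1, smul_eq_mul, mul_assoc]

lemma mulOp_injective {m : α → ℂ} (hm : BddMeas m) (h0 : ∀ x, m x ≠ 0) :
    Function.Injective (mulOp m : Lp ℂ 2 μ → Lp ℂ 2 μ) := by
  intro f g h
  refine Lp.ext ?_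
  filter_upwards [mulOp_ae hm f, mulOp_ae hm g] with x h1 h2
  rw [h, h2] at h1
  exact (mul_left_cancel₀ (h0 x) h1).symm

lemma inner_mulOp_left {m : α → ℂ} (hm : BddMeas m) (f g : Lp ℂ 2 μ) :
    inner ℂ (mulOp m f) g = inner ℂ f (mulOp (fun x => (starRingEnd ℂ) (m x)) g) := by
  rw [L2.inner_def, L2.inner_def]
  refine integral_congr_ae ?_
  filter_upwards [mulOp_ae hm f, mulOp_ae hm.conj g] with x h1 h2
  rw [h1, h2, ← smul_eq_mul, ← smul_eq_mul, inner_smul_left, inner_smul_right]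

/-- Dominated convergence for ∫ |m i - m₀|²|f|². Convergence is only strong, not in operator norm.
-/
lemma tendsto_mulOp {ι : Type*} {l : Filter ι} [l.IsCountablyGenerated] {m : ι → α → ℂ}
    {m₀ : α → ℂ} {C : ℝ} (hm : ∀ i, Measurable (m i)) (hC : ∀ i x, ‖m i x‖ ≤ C)
    (hm₀ : BddMeas m₀) (hlim : ∀ x, Filter.Tendsto (fun i => m i x) l (nhds (m₀ x)))
    (f : Lp ℂ 2 μ) : Filter.Tendsto (fun i => mulOp (m i) f) l (nhds (mulOp m₀ f)) := by
  obtain ⟨D, hD⟩ := hm₀.2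
  have hsq : Filter.Tendsto (fun i => ‖mulOp (m i) f - mulOp m₀ f‖ ^ 2) l (nhds 0) := by
    have h1 : ∀ i, ‖mulOp (m i) f - mulOp m₀ f‖ ^ 2
        = ∫ x, ‖m i x - m₀ x‖ ^ 2 * ‖f x‖ ^ 2 ∂μ := by
      intro i
      have hb : BddMeas (m i) := ⟨hm i, C, hC i⟩
      rw [← _root_.sub_apply, ← mulOp_sub hb hm₀, norm_sq_eq_integral]
      refine integral_congr_ae ?_
      filter_upwards [mulOp_ae (hb.sub hm₀) f] with x hx
      rw [hx, norm_mul, mul_pow]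
    have hint : Integrable (fun x => ‖f x‖ ^ 2) μ :=
      (memLp_two_iff_integrable_sq_norm (Lp.aestronglyMeasurable f)).1 (Lp.memLp f)
    have h2 := tendsto_integral_filter_of_dominated_convergence (l := l) (μ := μ)
      (F := fun i x => ‖m i x - m₀ x‖ ^ 2 * ‖f x‖ ^ 2) (f := fun _ => (0 : ℝ))
      (fun x => (C + D) ^ 2 * ‖f x‖ ^ 2)
      (Filter.Eventually.of_forall fun i =>
        ((((hm i).sub hm₀.1).norm.pow_const 2).aestronglyMeasurable).mul hint.1)
      (Filter.Eventually.of_forall fun i => Filter.Eventually.of_forall fun x => by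
        rw [Real.norm_of_nonneg (by positivity)]
        refine mul_le_mul_of_nonneg_right (pow_le_pow_left₀ (norm_nonneg _) ?_ 2) (by positivity)
        exact (norm_sub_le _ _).trans (add_le_add (hC i x) (hD x)))
      (hint.const_mul _)
      (Filter.Eventually.of_forall fun x => by
        have := (((hlim x).sub_const (m₀ x)).norm.pow 2).mul_const (‖f x‖ ^ 2)
        simpa using this)
    simpa [h1] using h2
  rw [tendsto_iff_norm_sub_tendsto_zero]
  have := hsq.sqrt
  simpa [Real.sqrt_sq (norm_nonneg _)] using this

/-- If the truncations `m n · f` of `m₀ · f` are bounded in `L²` then `m₀ · f ∈ L²`. -/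
lemma exists_ae_eq_mul_of_norm_le {m : ℕ → α → ℂ} {m₀ : α → ℂ} {C : ℝ}
    (hm : ∀ n, BddMeas (m n))
    (hlim : ∀ x, Filter.Tendsto (fun n => m n x) Filter.atTop (nhds (m₀ x)))
    {f : Lp ℂ 2 μ} (hC : ∀ n, ‖mulOp (m n) f‖ ≤ C) :
    ∃ g : Lp ℂ 2 μ, (g =ᵐ[μ] fun x => m₀ x * f x) ∧ ‖g‖ ≤ C := by
  have hC0 : 0 ≤ C := (norm_nonneg _).trans (hC 0)
  have hm₀ : Measurable m₀ :=
    measurable_of_tendsto_metrizable (fun n => (hm n).1) (tendsto_pi_nhds.2 hlim)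
  have hn : ∀ n, eLpNorm (fun x => m n x * f x) 2 μ ≤ ENNReal.ofReal C := by
    intro n
    rw [← eLpNorm_congr_ae (mulOp_ae (hm n) f), ← Lp.enorm_def, ← ofReal_norm]
    exact ENNReal.ofReal_le_ofReal (hC n)
  have hle : eLpNorm (fun x => m₀ x * f x) 2 μ ≤ ENNReal.ofReal C := by
    -- Fatou's lemma: the limit symbol may be unbounded, yet the product stays in `L²`.
    refine (Lp.eLpNorm_lim_le_liminf_eLpNorm
      (fun n => (hm n).1.aestronglyMeasurable.mul (Lp.aestronglyMeasurable f)) _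
      (Filter.Eventually.of_forall fun x => (hlim x).mul_const _)).trans ?_
    refine (Filter.liminf_le_liminf (Filter.Eventually.of_forall hn)).trans ?_
    simp
  have hmem : MemLp (fun x => m₀ x * f x) 2 μ :=
    ⟨hm₀.aestronglyMeasurable.mul (Lp.aestronglyMeasurable f), hle.trans_lt ENNReal.ofReal_lt_top⟩
  refine ⟨hmem.toLp _, hmem.coeFn_toLp, ?_⟩
  rw [Lp.norm_toLp]
  exact ENNReal.toReal_le_of_le_ofReal hC0 hle

end Multiplier

/-! ### `L²` functions as tempered distributions -/

lemma toDist_injective : Function.Injective (toDist (d := d)) := by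
  have h := Lp.ker_toTemperedDistributionCLM_eq_bot (F := ℂ) (p := 2)
    (μ := (volume : Measure (EuclideanSpace ℝ (Fin d))))
  exact LinearMap.ker_eq_bot.1 h

lemma toDist_mulOp {m : EuclideanSpace ℝ (Fin d) → ℂ} (hm : BddMeas m)
    (ht : m.HasTemperateGrowth) (f : L2 d) :
    toDist (mulOp m f) = TemperedDistribution.smulLeftCLM ℂ m (toDist f) := by
  ext φ
  rw [TemperedDistribution.smulLeftCLM_apply_apply, Lp.toTemperedDistribution_apply,
    Lp.toTemperedDistribution_apply]
  refine integral_congr_ae ?_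
  filter_upwards [mulOp_ae hm f] with x hx
  rw [hx, SchwartzMap.smulLeftCLM_apply_apply ht, smul_eq_mul, smul_eq_mul, smul_eq_mul]
  ring

lemma toDist_add (f g : L2 d) : toDist (f + g) = toDist f + toDist g :=
  (Lp.toTemperedDistributionCLM ℂ volume 2).map_add f g

lemma toDist_smul (c : ℂ) (f : L2 d) : toDist (c • f) = c • toDist f :=
  (Lp.toTemperedDistributionCLM ℂ volume 2).map_smul c f

/-- Testing an `L²` function against a fixed Schwartz function. -/
def testCLM (φ : 𝓢(EuclideanSpace ℝ (Fin d), ℂ)) : L2 d →L[ℂ] ℂ where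
  toFun f := toDist f φ
  map_add' f g := by rw [toDist_add]; rfl
  map_smul' c f := by rw [toDist_smul]; rfl
  cont := (PointwiseConvergenceCLM.evalCLM (RingHom.id ℂ) ℂ φ).continuous.comp
    (Lp.toTemperedDistributionCLM ℂ volume 2).continuous

lemma testCLM_apply (φ : 𝓢(EuclideanSpace ℝ (Fin d), ℂ)) (f : L2 d) :
    testCLM φ f = toDist f φ := rfl

/-! ### Global Lipschitz ODEs in Banach spaces -/

section ODE

variable {X : Type*} [NormedAddCommGroup X] [NormedSpace ℝ X]

/-- Integration in time gains a factor 1/k in the sup norm weighted by e^{-k|t|}, which makes the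
Picard map contract for large k. -/
lemma abs_integral_exp_mul_abs_le {k : ℝ} (hk : 0 < k) (t : ℝ) :
    |∫ s in (0 : ℝ)..t, Real.exp (k * |s|)| ≤ Real.exp (k * |t|) / k := by
  have hpos : ∀ t : ℝ, 0 ≤ t →
      |∫ s in (0 : ℝ)..t, Real.exp (k * |s|)| ≤ Real.exp (k * |t|) / k := by
    intro t ht
    have h1 : ∫ s in (0 : ℝ)..t, Real.exp (k * |s|) = ∫ s in (0 : ℝ)..t, Real.exp (k * s) := by
      refine intervalIntegral.integral_congr fun s hs => ?_
      rw [Set.uIcc_of_le ht] at hs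
      simp only [abs_of_nonneg hs.1]
    rw [h1, intervalIntegral.integral_comp_mul_left _ hk.ne', integral_exp, abs_of_nonneg ht,
      smul_eq_mul, mul_zero, Real.exp_zero, ← div_eq_inv_mul, abs_of_nonneg]
    · gcongr; linarith
    · refine div_nonneg (sub_nonneg.2 (Real.one_le_exp (by positivity))) hk.le
  rcases le_total 0 t with ht | ht
  · exact hpos t ht
  · have h := hpos (-t) (by linarith)
    have h2 := intervalIntegral.integral_comp_neg (a := 0) (b := t)
      (fun s => Real.exp (k * |s|))
    simp only [abs_neg, neg_zero] at h2
    rw [h2, intervalIntegral.integral_symm, abs_neg]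
    simpa using h

lemma norm_sub_le_of_integralCurves {F : ℝ → X → X} {K : NNReal}
    (hLip : ∀ t x y, ‖F t x - F t y‖ ≤ K * ‖x - y‖) {u v : ℝ → X}
    (hu : ∀ t, HasDerivAt u (F t (u t)) t) (hv : ∀ t, HasDerivAt v (F t (v t)) t) (t : ℝ) :
    ‖u t - v t‖ ≤ ‖u 0 - v 0‖ * Real.exp (K * |t|) := by
  have hpos : ∀ (F : ℝ → X → X) (u v : ℝ → X),
      (∀ t x y, ‖F t x - F t y‖ ≤ K * ‖x - y‖) → (∀ t, HasDerivAt u (F t (u t)) t) →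
      (∀ t, HasDerivAt v (F t (v t)) t) → ∀ t, 0 ≤ t →
      ‖u t - v t‖ ≤ ‖u 0 - v 0‖ * Real.exp (K * t) := by
    intro F u v hLip hu hv t ht
    have := dist_le_of_trajectories_ODE (v := F) (K := K) (f := u) (g := v) (a := 0) (b := t)
      (δ := dist (u 0) (v 0))
      (fun s => LipschitzWith.of_dist_le_mul fun x y => by
        simpa [dist_eq_norm] using hLip s x y)
      (fun s _ => (hu s).continuousAt.continuousWithinAt)
      (fun s _ => (hu s).hasDerivWithinAt)
      (fun s _ => (hv s).continuousAt.continuousWithinAt)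
      (fun s _ => (hv s).hasDerivWithinAt) le_rfl t (Set.right_mem_Icc.2 ht)
    simpa [dist_eq_norm] using this
  rcases le_total 0 t with ht | ht
  · simpa [abs_of_nonneg ht] using hpos F u v hLip hu hv t ht
  -- Negative times reduce to positive ones: t ↦ w(-t) solves the ODE with the field -F(-t, ·),
  -- which has the same Lipschitz constant.
  · have hrev : ∀ w : ℝ → X, (∀ t, HasDerivAt w (F t (w t)) t) →
        ∀ s, HasDerivAt (fun s => w (-s)) (-F (-s) (w (-s))) s := fun w hw s => by
      have h := (hw (-s)).scomp s (hasDerivAt_neg s)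
      rw [neg_one_smul] at h
      exact h
    have := hpos (fun s x => -F (-s) x) (fun s => u (-s)) (fun s => v (-s))
      (fun s x y => by rw [← neg_sub', norm_neg]; exact hLip _ _ _) (hrev u hu) (hrev v hv)
      (-t) (by linarith)
    simpa [abs_of_nonpos ht] using this

variable [CompleteSpace X]

open BoundedContinuousFunction in
/-- A globally Lipschitz, continuous, time-dependent vector field vanishing at the origin has a
global integral curve through every point. -/
theorem exists_global_integralCurve {F : ℝ → X → X} {K : ℝ} (hK : 0 ≤ K)
    (hF : Continuous fun p : ℝ × X => F p.1 p.2)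
    (hLip : ∀ t x y, ‖F t x - F t y‖ ≤ K * ‖x - y‖) (h0 : ∀ t, F t 0 = 0) (x₀ : X) :
    ∃ u : ℝ → X, u 0 = x₀ ∧ ∀ t, HasDerivAt u (F t (u t)) t := by
  -- The unknown is g = e^{-k|t|}u among bounded continuous functions. This k gives the contraction
  -- factor K/k ≤ 1/2 on all of ℝ at once, so no local solutions need gluing.
  set k : ℝ := 2 * K + 1 with hk
  have hk0 : 0 < k := by positivity
  set e : ℝ → ℝ := fun t => Real.exp (k * |t|) with he
  have he0 : ∀ t, 0 < e t := fun t => Real.exp_pos _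
  have he1 : ∀ t, 1 ≤ e t := fun t => Real.one_le_exp (by positivity)
  have hec : Continuous e := by fun_prop
  -- Vanishing at the origin gives linear growth, so the Picard map preserves boundedness of g.
  have hF0 : ∀ t x, ‖F t x‖ ≤ K * ‖x‖ := fun t x => by simpa [h0] using hLip t x 0
  have hcont : ∀ g : ℝ → X, Continuous g → Continuous fun s => F s (e s • g s) := fun g hg =>
    hF.comp (continuous_id.prodMk (hec.smul hg))
  have hbound : ∀ (h : ℝ → X) (D : ℝ), (∀ s, ‖h s‖ ≤ D * e s) → ∀ t,
      ‖(e t)⁻¹ • ∫ s in (0 : ℝ)..t, h s‖ ≤ D / k := by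
    intro h D hD t
    have hD0 : 0 ≤ D := by
      have := (norm_nonneg _).trans (hD 0)
      exact nonneg_of_mul_nonneg_left this (he0 0)
    have h1 : ‖∫ s in (0 : ℝ)..t, h s‖ ≤ |∫ s in (0 : ℝ)..t, D * e s| :=
      intervalIntegral.norm_integral_le_abs_of_norm_le
        (Filter.Eventually.of_forall fun s => hD s)
        ((continuous_const.mul hec).intervalIntegrable _ _)
    rw [intervalIntegral.integral_const_mul, abs_mul, abs_of_nonneg hD0] at h1
    have h2 := abs_integral_exp_mul_abs_le hk0 t
    rw [norm_smul, norm_inv, Real.norm_of_nonneg (he0 t).le, inv_mul_le_iff₀ (he0 t)]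
    calc _ ≤ D * (e t / k) := h1.trans (mul_le_mul_of_nonneg_left h2 hD0)
      _ = _ := by ring
  have hbd : ∀ g : ℝ →ᵇ X, ∀ s, ‖F s (e s • g s)‖ ≤ K * ‖g‖ * e s := fun g s => by
    refine (hF0 _ _).trans ?_
    rw [norm_smul, Real.norm_of_nonneg (he0 s).le, mul_assoc, mul_comm (e s)]
    exact mul_le_mul_of_nonneg_left
      (mul_le_mul_of_nonneg_right (g.norm_coe_le_norm s) (he0 s).le) hK
  let Φ : (ℝ →ᵇ X) → (ℝ →ᵇ X) := fun g =>
    BoundedContinuousFunction.ofNormedAddCommGroup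
      (fun t => (e t)⁻¹ • (x₀ + ∫ s in (0 : ℝ)..t, F s (e s • g s)))
      ((hec.inv₀ fun t => (he0 t).ne').smul (continuous_const.add
        (intervalIntegral.continuous_primitive
          (fun a b => (hcont g g.continuous).intervalIntegrable a b) 0)))
      (‖x₀‖ + K * ‖g‖ / k)
      (fun t => by
        rw [smul_add]
        refine (norm_add_le _ _).trans (add_le_add ?_ (hbound _ _ (hbd g) t))
        rw [norm_smul, norm_inv, Real.norm_of_nonneg (he0 t).le]
        exact mul_le_of_le_one_left (norm_nonneg _) (inv_le_one_of_one_le₀ (he1 t)))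
  have hΦ : ContractingWith (1 / 2) Φ := by
    refine ⟨by rw [← NNReal.coe_lt_coe]; norm_num, LipschitzWith.of_dist_le_mul fun g h => ?_⟩
    rw [BoundedContinuousFunction.dist_le (by positivity)]
    intro t
    change dist ((e t)⁻¹ • (x₀ + ∫ s in (0 : ℝ)..t, F s (e s • g s)))
      ((e t)⁻¹ • (x₀ + ∫ s in (0 : ℝ)..t, F s (e s • h s))) ≤ _
    rw [dist_eq_norm, ← smul_sub, add_sub_add_left_eq_sub, ← intervalIntegral.integral_sub
      ((hcont g g.continuous).intervalIntegrable _ _)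
      ((hcont h h.continuous).intervalIntegrable _ _)]
    refine (hbound _ (K * dist g h) (fun s => ?_) t).trans ?_
    · refine (hLip _ _ _).trans ?_
      rw [← smul_sub, norm_smul, Real.norm_of_nonneg (he0 s).le, mul_assoc, mul_comm (e s),
        ← dist_eq_norm]
      exact mul_le_mul_of_nonneg_left
        (mul_le_mul_of_nonneg_right (BoundedContinuousFunction.dist_coe_le_dist s) (he0 s).le) hK
    · rw [div_le_iff₀ hk0]
      have : (0 : ℝ) ≤ dist g h := dist_nonneg
      push_cast
      nlinarith
  obtain ⟨g, hg⟩ : ∃ g, Φ g = g := ⟨hΦ.fixedPoint, hΦ.fixedPoint_isFixedPt⟩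
  have hg' : ∀ t, e t • g t = x₀ + ∫ s in (0 : ℝ)..t, F s (e s • g s) := by
    intro t
    have : g t = (e t)⁻¹ • (x₀ + ∫ s in (0 : ℝ)..t, F s (e s • g s)) := by
      conv_lhs => rw [← hg]
      rfl
    rw [this, smul_inv_smul₀ (he0 t).ne']
  refine ⟨fun t => e t • g t, (hg' 0).trans (by rw [intervalIntegral.integral_same, add_zero]), fun t => ?_⟩
  have h1 := ((hcont g g.continuous).integral_hasStrictDerivAt 0 t).hasDerivAt.const_add x₀
  exact h1.congr_of_eventuallyEq (Filter.Eventually.of_forall hg')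

end ODE

end SatNLS
end

/-! ### Weak-to-strong differentiability and the free propagator -/

noncomputable section

namespace SatNLS

open FourierTransform Complex

/-- If `V` is differentiable with continuous derivative when tested against a separating family of
continuous linear maps, it is differentiable in norm. -/
lemma hasDerivAt_of_separating {ι X Y : Type*} [NormedAddCommGroup X] [NormedSpace ℝ X]
    [CompleteSpace X] [NormedAddCommGroup Y] [NormedSpace ℝ Y] (L : ι → X →L[ℝ] Y)
    (hL : ∀ x, (∀ i, L i x = 0) → x = 0) {V Z : ℝ → X} (hZ : Continuous Z)
    (h : ∀ i t, HasDerivAt (fun s => L i (V s)) (L i (Z t)) t) (t : ℝ) :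
    HasDerivAt V (Z t) t := by
  have hI : ∀ t, HasDerivAt (fun t => ∫ s in (0 : ℝ)..t, Z s) (Z t) t := fun t =>
    (hZ.integral_hasStrictDerivAt 0 t).hasDerivAt
  -- Each `L i` sends V minus the primitive of Z to a function with zero derivative, hence to a
  -- constant; separation then identifies V itself.
  have key : ∀ t, V t = V 0 + ∫ s in (0 : ℝ)..t, Z s := by
    intro t
    rw [← sub_eq_zero]
    refine hL _ fun i => ?_
    have h0 : ∀ t, HasDerivAt (fun t => L i (V t) - L i (∫ s in (0 : ℝ)..t, Z s)) 0 t := by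
      intro t
      have := (h i t).sub ((L i).hasFDerivAt.comp_hasDerivAt t (hI t))
      rwa [sub_self] at this
    have hc := is_const_of_deriv_eq_zero (fun t => (h0 t).differentiableAt)
      (fun t => (h0 t).deriv) t 0
    simp only [intervalIntegral.integral_same, map_zero, sub_zero] at hc
    rw [map_sub, map_add, ← hc]
    abel
  exact ((hI t).const_add (V 0)).congr_of_eventuallyEq (Filter.Eventually.of_forall key)

section Propagator

variable {d : ℕ}

/-- The dispersion relation `ω(ξ) = (2π)² |ξ|²`. -/
def dispersion (ξ : EuclideanSpace ℝ (Fin d)) : ℝ := (2 * Real.pi) ^ 2 * ‖ξ‖ ^ 2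

/-- The Fourier multiplier `e^{itω}`. -/
def phase (t : ℝ) (ξ : EuclideanSpace ℝ (Fin d)) : ℂ := cexp ((t * dispersion ξ : ℝ) * I)

/-- The weight `(1 + |ξ|²)⁻²`. -/
def weight (ξ : EuclideanSpace ℝ (Fin d)) : ℂ := (((1 + ‖ξ‖ ^ 2) ^ (-2 : ℝ) : ℝ) : ℂ)

lemma continuous_dispersion : Continuous (dispersion (d := d)) := by
  unfold dispersion; fun_prop

lemma dispersion_nonneg (ξ : EuclideanSpace ℝ (Fin d)) : 0 ≤ dispersion ξ := by
  unfold dispersion; positivity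

lemma norm_phase (t : ℝ) (ξ : EuclideanSpace ℝ (Fin d)) : ‖phase t ξ‖ = 1 :=
  norm_exp_ofReal_mul_I _

lemma continuous_phase (t : ℝ) : Continuous (phase t : EuclideanSpace ℝ (Fin d) → ℂ) := by
  have := continuous_dispersion (d := d)
  unfold phase; fun_prop

lemma bddMeas_phase (t : ℝ) : BddMeas (phase t : EuclideanSpace ℝ (Fin d) → ℂ) :=
  ⟨(continuous_phase t).measurable, 1, fun ξ => (norm_phase t ξ).le⟩

lemma phase_mul_phase (s t : ℝ) (ξ : EuclideanSpace ℝ (Fin d)) :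
    phase s ξ * phase t ξ = phase (s + t) ξ := by
  rw [phase, phase, phase, ← Complex.exp_add]
  congr 1; push_cast; ring

lemma phase_zero (ξ : EuclideanSpace ℝ (Fin d)) : phase 0 ξ = 1 := by simp [phase]

lemma weight_eq (ξ : EuclideanSpace ℝ (Fin d)) :
    weight ξ = ((((1 + ‖ξ‖ ^ 2) ^ 2)⁻¹ : ℝ) : ℂ) := by
  rw [weight, Real.rpow_neg (by positivity)]
  norm_num

lemma weight_ne_zero (ξ : EuclideanSpace ℝ (Fin d)) : weight ξ ≠ 0 := by
  rw [weight_eq]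
  exact_mod_cast (by positivity : (((1 + ‖ξ‖ ^ 2) ^ 2)⁻¹ : ℝ) ≠ 0)

lemma norm_weight (ξ : EuclideanSpace ℝ (Fin d)) : ‖weight ξ‖ = ((1 + ‖ξ‖ ^ 2) ^ 2)⁻¹ := by
  rw [weight_eq, Complex.norm_real, Real.norm_of_nonneg (by positivity)]

lemma hasTemperateGrowth_one_add_sq_rpow (r : ℝ) :
    (fun ξ : EuclideanSpace ℝ (Fin d) => (((1 + ‖ξ‖ ^ 2) ^ r : ℝ) : ℂ)).HasTemperateGrowth := by
  fun_prop

lemma hasTemperateGrowth_weight :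
    (weight : EuclideanSpace ℝ (Fin d) → ℂ).HasTemperateGrowth :=
  hasTemperateGrowth_one_add_sq_rpow _

lemma hasTemperateGrowth_dispersion :
    (fun ξ : EuclideanSpace ℝ (Fin d) => (dispersion ξ : ℂ)).HasTemperateGrowth := by
  unfold dispersion; fun_prop

lemma measurable_weight : Measurable (weight : EuclideanSpace ℝ (Fin d) → ℂ) :=
  hasTemperateGrowth_weight.1.continuous.measurable

lemma norm_weight_le_one (ξ : EuclideanSpace ℝ (Fin d)) : ‖weight ξ‖ ≤ 1 := by
  rw [norm_weight]
  refine inv_le_one_of_one_le₀ ?_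
  nlinarith [sq_nonneg ‖ξ‖, sq_nonneg (‖ξ‖ ^ 2)]

lemma bddMeas_weight : BddMeas (weight : EuclideanSpace ℝ (Fin d) → ℂ) :=
  ⟨measurable_weight, 1, norm_weight_le_one⟩

/-- The exponent -2 in `weight` is chosen for this: it absorbs the ω² in the second-order Taylor
remainder of e^{itω}. -/
lemma dispersion_sq_mul_norm_weight_le (ξ : EuclideanSpace ℝ (Fin d)) :
    dispersion ξ ^ 2 * ‖weight ξ‖ ≤ (2 * Real.pi) ^ 4 := by
  rw [norm_weight, ← div_eq_mul_inv, div_le_iff₀ (by positivity), dispersion]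
  calc _ = (2 * Real.pi) ^ 4 * (‖ξ‖ ^ 2) ^ 2 := by ring
    _ ≤ _ := by gcongr; linarith

lemma bddMeas_dispersion_mul_weight :
    BddMeas fun ξ : EuclideanSpace ℝ (Fin d) => (dispersion ξ : ℂ) * weight ξ := by
  refine ⟨(continuous_ofReal.comp continuous_dispersion).measurable.mul measurable_weight,
    1 + (2 * Real.pi) ^ 4, fun ξ => ?_⟩
  have h0 := dispersion_nonneg ξ
  rw [norm_mul, Complex.norm_real, Real.norm_of_nonneg h0]
  have h1 := dispersion_sq_mul_norm_weight_le ξ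
  have h2 := norm_weight_le_one ξ
  nlinarith [norm_nonneg (weight ξ), mul_nonneg (sq_nonneg (dispersion ξ - 1)) (norm_nonneg (weight ξ))]

/-- The operator `e^{itω}` on `L²`; it is the inverse free flow on the Fourier side. -/
def propagator (t : ℝ) : L2 d →L[ℂ] L2 d := mulOp (phase t)

lemma norm_propagator (t : ℝ) (f : L2 d) : ‖propagator t f‖ = ‖f‖ :=
  norm_mulOp_eq (continuous_phase t).measurable (norm_phase t) f

lemma propagator_propagator (s t : ℝ) (f : L2 d) :
    propagator s (propagator t f) = propagator (s + t) f := by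
  rw [propagator, propagator, mulOp_mulOp (bddMeas_phase s) (bddMeas_phase t)]
  simp only [phase_mul_phase, propagator]

lemma propagator_zero (f : L2 d) : propagator 0 f = f := by
  have : (phase 0 : EuclideanSpace ℝ (Fin d) → ℂ) = fun _ => 1 := funext phase_zero
  rw [propagator, this, mulOp_one]

lemma propagator_neg_propagator (t : ℝ) (f : L2 d) : propagator (-t) (propagator t f) = f := by
  rw [propagator_propagator, neg_add_cancel, propagator_zero]

/-- Strong continuity in time and the isometry property together give joint continuity. -/
lemma continuous_propagator : Continuous fun p : ℝ × L2 d => propagator p.1 p.2 := by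
  refine continuous_iff_continuousAt.2 fun ⟨t, f⟩ => ?_
  have h1 : Filter.Tendsto (fun s => propagator s f) (nhds t) (nhds (propagator t f)) := by
    refine tendsto_mulOp (C := 1) (fun s => (continuous_phase s).measurable)
      (fun s ξ => (norm_phase s ξ).le) (bddMeas_phase t) (fun ξ => ?_) f
    exact Continuous.tendsto (by unfold phase; fun_prop) t
  have h2 : Filter.Tendsto (fun p : ℝ × L2 d => propagator p.1 (p.2 - f)) (nhds (t, f))
      (nhds 0) := by
    rw [tendsto_zero_iff_norm_tendsto_zero]
    simp only [norm_propagator]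
    exact Continuous.tendsto' (by fun_prop) _ _ (by simp)
  have h3 := h2.add (h1.comp (continuous_fst.tendsto (t, f)))
  simp only [zero_add] at h3
  refine h3.congr fun p => ?_
  simp

lemma inner_propagator (t : ℝ) (f g : L2 d) :
    inner ℂ (propagator t f) (propagator t g) = inner ℂ f g := by
  have : (fun ξ : EuclideanSpace ℝ (Fin d) => (starRingEnd ℂ) (phase t ξ)) = phase (-t) := by
    funext ξ
    rw [phase, phase, ← Complex.exp_conj, map_mul, conj_ofReal, conj_I]
    congr 1; push_cast; ring
  rw [propagator, inner_mulOp_left (bddMeas_phase t), this]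
  change inner ℂ f (propagator (-t) (propagator t g)) = _
  rw [propagator_neg_propagator]

/-- For |x| ≤ 1 this is the Taylor bound; for |x| ≥ 1, |e^{ix} - 1| ≤ |x| gives 2|x| ≤ 2x². -/
lemma norm_exp_mul_I_sub_le (x : ℝ) : ‖cexp (x * I) - 1 - x * I‖ ≤ 2 * x ^ 2 := by
  have hx : ‖(x : ℂ) * I‖ = |x| := by simp
  rcases le_total |x| 1 with h | h
  · have := Complex.norm_exp_sub_one_sub_id_le (hx.trans_le h)
    rw [hx, sq_abs] at this
    nlinarith [sq_nonneg x]
  · have h1 : ‖cexp (x * I) - 1‖ ≤ 2 := by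
      refine (norm_sub_le _ _).trans ?_
      rw [norm_exp_ofReal_mul_I, norm_one]; norm_num
    refine (norm_sub_le _ _).trans ?_
    rw [hx, ← sq_abs]
    by_cases h2 : |x| ≤ 1
    · have h3 : |x| = 1 := le_antisymm h2 h
      have h4 : ‖cexp (x * I) - 1‖ ≤ ‖x‖ := by
        rw [mul_comm]; exact Real.norm_exp_I_mul_ofReal_sub_one_le
      rw [Real.norm_eq_abs] at h4
      nlinarith
    · have h4 : ‖cexp (x * I) - 1‖ ≤ ‖x‖ := by
        rw [mul_comm]; exact Real.norm_exp_I_mul_ofReal_sub_one_le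
      rw [Real.norm_eq_abs] at h4
      nlinarith

/-- The phase alone is not differentiable on all of `L²`. After weighting, the remainder symbol is
O((s-t)² ω² |weight|), hence O((s-t)²) uniformly in ξ, which gives differentiability in operator
norm. -/
lemma hasDerivAt_phase_mul_weight (t : ℝ) :
    HasDerivAt (fun s => (mulOp fun ξ => phase s ξ * weight ξ : L2 d →L[ℂ] L2 d))
      (mulOp fun ξ => I * (phase t ξ * (dispersion ξ * weight ξ))) t := by
  have hb1 : ∀ s, BddMeas fun ξ : EuclideanSpace ℝ (Fin d) => phase s ξ * weight ξ := fun s =>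
    (bddMeas_phase s).mul bddMeas_weight
  have hb2 : BddMeas fun ξ : EuclideanSpace ℝ (Fin d) =>
      I * (phase t ξ * (dispersion ξ * weight ξ)) :=
    ((bddMeas_phase t).mul bddMeas_dispersion_mul_weight).const_mul I
  rw [hasDerivAt_iff_isLittleO]
  have h0 : (fun s : ℝ => (s - t) ^ 2) =o[nhds t] fun s => s - t := by
    refine (Asymptotics.isLittleO_pow_id (𝕜 := ℝ) one_lt_two).comp_tendsto
      ((by fun_prop : Continuous fun s : ℝ => s - t).tendsto' _ _ (by simp))
  refine Asymptotics.IsBigO.trans_isLittleO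
    (Asymptotics.IsBigO.of_bound (2 * (2 * Real.pi) ^ 4) (Filter.Eventually.of_forall fun s => ?_)) h0
  rw [RCLike.real_smul_eq_coe_smul (K := ℂ) (s - t), ← mulOp_const_mul hb2, ← mulOp_sub (hb1 s) (hb1 t),
    ← mulOp_sub ((hb1 s).sub (hb1 t)) (hb2.const_mul _)]
  refine norm_mulOp_le (((hb1 s).sub (hb1 t)).sub (hb2.const_mul _)).1 (by positivity) fun ξ => ?_
  have e1 : phase s ξ * weight ξ - phase t ξ * weight ξ
      - ((s - t : ℝ) : ℂ) * (I * (phase t ξ * (dispersion ξ * weight ξ)))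
      = phase t ξ * weight ξ * (cexp (((s - t) * dispersion ξ : ℝ) * I) - 1
        - ((s - t) * dispersion ξ : ℝ) * I) := by
    have : phase s ξ = phase t ξ * cexp (((s - t) * dispersion ξ : ℝ) * I) := by
      rw [phase, phase, ← Complex.exp_add]; congr 1; push_cast; ring
    rw [this]; push_cast; ring
  refine (le_of_eq (congrArg norm e1)).trans ?_
  rw [norm_mul, norm_mul, norm_phase, one_mul, Real.norm_of_nonneg (sq_nonneg _)]
  calc _ ≤ ‖weight ξ‖ * (2 * ((s - t) * dispersion ξ) ^ 2) :=
        mul_le_mul_of_nonneg_left (norm_exp_mul_I_sub_le _) (norm_nonneg _)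
    _ = 2 * (s - t) ^ 2 * (dispersion ξ ^ 2 * ‖weight ξ‖) := by ring
    _ ≤ 2 * (s - t) ^ 2 * (2 * Real.pi) ^ 4 :=
        mul_le_mul_of_nonneg_left (dispersion_sq_mul_norm_weight_le ξ) (by positivity)
    _ = _ := by ring

lemma hasDerivAt_complexCLM_apply {X Y : Type*} [NormedAddCommGroup X] [NormedSpace ℂ X]
    [NormedSpace ℝ X] [IsScalarTower ℝ ℂ X] [NormedAddCommGroup Y] [NormedSpace ℂ Y]
    [NormedSpace ℝ Y] [IsScalarTower ℝ ℂ Y] [SMulCommClass ℂ ℝ Y] {c : ℝ → X →L[ℂ] Y} {c' : X →L[ℂ] Y} {u : ℝ → X}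
    {u' : X} {t : ℝ} (hc : HasDerivAt c c' t) (hu : HasDerivAt u u' t) :
    HasDerivAt (fun s => c s (u s)) (c' (u t) + c t u') t := by
  have h := (ContinuousLinearMap.restrictScalarsL ℂ X Y ℝ ℝ).hasFDerivAt.comp_hasDerivAt t hc
  exact h.clm_apply hu

lemma hasDerivAt_complexCLM_comp {X Y : Type*} [NormedAddCommGroup X]
    [NormedSpace ℂ X] [NormedSpace ℝ X] [IsScalarTower ℝ ℂ X] [NormedAddCommGroup Y]
    [NormedSpace ℂ Y] [NormedSpace ℝ Y] [IsScalarTower ℝ ℂ Y] (L : X →L[ℂ] Y) {u : ℝ → X}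
    {u' : X} {t : ℝ} (hu : HasDerivAt u u' t) :
    HasDerivAt (fun s => L (u s)) (L u') t :=
  (L.restrictScalars ℝ).hasFDerivAt.comp_hasDerivAt t hu

lemma hasDerivAt_propagator_weight {u : ℝ → L2 d} {u' : L2 d} {t : ℝ} (hu : HasDerivAt u u' t) :
    HasDerivAt (fun s => mulOp weight (propagator s (u s)))
      (I • mulOp (fun ξ => dispersion ξ * weight ξ) (propagator t (u t))
        + mulOp weight (propagator t u')) t := by
  have h := hasDerivAt_complexCLM_apply (hasDerivAt_phase_mul_weight t) hu
  have e1 : ∀ s (f : L2 d), mulOp (fun ξ => phase s ξ * weight ξ) f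
      = mulOp weight (propagator s f) := fun s f => by
    rw [propagator, mulOp_comm bddMeas_weight (bddMeas_phase s),
      mulOp_mulOp (bddMeas_phase s) bddMeas_weight]
  rw [mulOp_const_mul ((bddMeas_phase t).mul bddMeas_dispersion_mul_weight), _root_.smul_apply,
    ← mulOp_mulOp (bddMeas_phase t) bddMeas_dispersion_mul_weight,
    mulOp_comm (bddMeas_phase t) bddMeas_dispersion_mul_weight] at h
  simp only [e1] at h
  exact h

end Propagator

/-! ### The interaction picture and its equivalence with the distributional equation -/

variable {d : ℕ}

/-- The vector field of the equation in the interaction picture, on the Fourier side. -/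
def profileField (a : ℝ) (t : ℝ) (v : L2 d) : L2 d :=
  (I * a) • propagator t (𝓕 (satL2 (𝓕⁻ (propagator (-t) v))))

lemma norm_fourierInv_eq (f : L2 d) : ‖(𝓕⁻ f : L2 d)‖ = ‖f‖ :=
  (Lp.fourierTransformₗᵢ (EuclideanSpace ℝ (Fin d)) ℂ).symm.norm_map f

lemma continuous_fourier_L2 : Continuous fun f : L2 d => (𝓕 f : L2 d) :=
  (Lp.fourierTransformₗᵢ (EuclideanSpace ℝ (Fin d)) ℂ).continuous

lemma continuous_fourierInv_L2 : Continuous fun f : L2 d => (𝓕⁻ f : L2 d) :=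
  (Lp.fourierTransformₗᵢ (EuclideanSpace ℝ (Fin d)) ℂ).symm.continuous

lemma continuous_profileField (a : ℝ) :
    Continuous fun p : ℝ × L2 d => profileField a p.1 p.2 := by
  have h1 : Continuous fun p : ℝ × L2 d => propagator (-p.1) p.2 :=
    continuous_propagator.comp (continuous_fst.neg.prodMk continuous_snd)
  have h2 : Continuous fun p : ℝ × L2 d => (𝓕 (satL2 (𝓕⁻ (propagator (-p.1) p.2))) : L2 d) :=
    continuous_fourier_L2.comp (continuous_satL2.comp (continuous_fourierInv_L2.comp h1))
  exact (continuous_propagator.comp (continuous_fst.prodMk h2)).const_smul (I * (a : ℂ))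

lemma fourier_sub_L2 (f g : L2 d) : (𝓕 (f - g) : L2 d) = 𝓕 f - 𝓕 g :=
  (Lp.fourierTransformₗᵢ (EuclideanSpace ℝ (Fin d)) ℂ).map_sub f g

lemma fourierInv_sub_L2 (f g : L2 d) : (𝓕⁻ (f - g) : L2 d) = 𝓕⁻ f - 𝓕⁻ g :=
  (Lp.fourierTransformₗᵢ (EuclideanSpace ℝ (Fin d)) ℂ).symm.map_sub f g

lemma norm_profileField_sub_le {a : ℝ} (ha : |a| = 1) (t : ℝ) (v w : L2 d) :
    ‖profileField a t v - profileField a t w‖ ≤ (3 : NNReal) * ‖v - w‖ := by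
  rw [profileField, profileField, ← smul_sub, norm_smul, norm_mul, norm_I, one_mul,
    Complex.norm_real, Real.norm_eq_abs, ha, one_mul, ← map_sub, norm_propagator,
    ← fourier_sub_L2, Lp.norm_fourier_eq]
  refine (norm_satL2_sub_le _ _).trans ?_
  rw [← fourierInv_sub_L2, norm_fourierInv_eq, ← map_sub, norm_propagator]
  rfl

lemma profileField_zero (a t : ℝ) : profileField a t (0 : L2 d) = 0 := by
  have h1 : (𝓕⁻ (0 : L2 d) : L2 d) = 0 :=
    (Lp.fourierTransformₗᵢ (EuclideanSpace ℝ (Fin d)) ℂ).symm.map_zero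
  have h2 : (𝓕 (0 : L2 d) : L2 d) = 0 :=
    (Lp.fourierTransformₗᵢ (EuclideanSpace ℝ (Fin d)) ℂ).map_zero
  rw [profileField, map_zero, h1, satL2_zero, h2, map_zero, smul_zero]

lemma fourier_laplacian (f : 𝓢'(EuclideanSpace ℝ (Fin d), ℂ)) :
    𝓕 (Δ f) = -TemperedDistribution.smulLeftCLM ℂ (fun ξ => (dispersion ξ : ℂ)) (𝓕 f) := by
  have h : (fun ξ : EuclideanSpace ℝ (Fin d) => (dispersion ξ : ℂ))
      = ((2 * Real.pi : ℂ) ^ 2) • fun ξ => ((‖ξ‖ ^ 2 : ℝ) : ℂ) := by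
    funext ξ; simp [dispersion]
  rw [h, TemperedDistribution.smulLeftCLM_smul (by fun_prop),
    TemperedDistribution.laplacian_eq_fourierMultiplierCLM,
    TemperedDistribution.fourierMultiplierCLM_apply]
  ext φ
  have e : ∀ (c : ℝ) (T : 𝓢'(EuclideanSpace ℝ (Fin d), ℂ)) (ψ : 𝓢(EuclideanSpace ℝ (Fin d), ℂ)),
    (c • T) ψ = c * T ψ := fun c T ψ => by
      change c • T ψ = _
      simp
  rw [TemperedDistribution.fourier_apply, e, ← TemperedDistribution.fourier_apply,
    fourier_fourierInv_eq]
  change _ = -((2 * Real.pi : ℂ) ^ 2 * (TemperedDistribution.smulLeftCLM ℂ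
    (fun ξ : EuclideanSpace ℝ (Fin d) => ((‖ξ‖ ^ 2 : ℝ) : ℂ)) (𝓕 f)) φ)
  push_cast
  ring

/-- The right-hand side of the equation solved for `∂ₜA`, on the Fourier side and weighted. -/
lemma toDist_weighted_velocity (a : ℝ) (f : L2 d) :
    toDist ((-I) • mulOp (fun ξ => dispersion ξ * weight ξ) (𝓕 f)
      + (I * a) • mulOp weight (𝓕 (satL2 f)))
    = TemperedDistribution.smulLeftCLM ℂ weight
        (𝓕 (I • Δ (toDist f) + (I * a) • toDist (satL2 f))) := by
  have hd : (fun ξ : EuclideanSpace ℝ (Fin d) => (dispersion ξ : ℂ) * weight ξ).HasTemperateGrowth :=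
    hasTemperateGrowth_dispersion.mul hasTemperateGrowth_weight
  have hneg : ∀ T : 𝓢'(EuclideanSpace ℝ (Fin d), ℂ), (-I) • T = I • (-T) := fun T => by
    ext φ
    change (-I) * T φ = I * (-(T φ))
    ring
  rw [toDist_add, toDist_smul, toDist_smul, toDist_mulOp bddMeas_dispersion_mul_weight hd,
    toDist_mulOp bddMeas_weight hasTemperateGrowth_weight, FourierTransform.fourier_add,
    FourierTransform.fourier_smul, FourierTransform.fourier_smul,
    fourier_laplacian, Lp.fourier_toTemperedDistribution_eq, Lp.fourier_toTemperedDistribution_eq,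
    map_add, map_smul, map_smul, map_neg, TemperedDistribution.smulLeftCLM_smulLeftCLM_apply
      hasTemperateGrowth_dispersion hasTemperateGrowth_weight, hneg]
  rfl

/-- The weight and the Fourier transform pass to the test function, which stays Schwartz; the
distributional time derivative thus applies to the weighted transform. -/
lemma toDist_mulOp_weight_apply (f : L2 d) (φ : 𝓢(EuclideanSpace ℝ (Fin d), ℂ)) :
    toDist (mulOp weight (𝓕 f)) φ
      = toDist f (𝓕 (SchwartzMap.smulLeftCLM ℂ weight φ)) := by
  have h : toDist (𝓕 f) = 𝓕 (toDist f) := (Lp.fourier_toTemperedDistribution_eq f).symm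
  rw [toDist_mulOp bddMeas_weight hasTemperateGrowth_weight, h]
  rfl

lemma continuous_profile {A : ℝ → L2 d} (hA : Continuous A) :
    Continuous fun t => propagator t (𝓕 (A t)) :=
  continuous_propagator.comp (continuous_id.prodMk (continuous_fourier_L2.comp hA))

lemma profileField_profile (a t : ℝ) (f : L2 d) :
    profileField a t (propagator t (𝓕 f)) = (I * a) • propagator t (𝓕 (satL2 f)) := by
  rw [profileField, propagator_neg_propagator, fourierInv_fourier_eq]

/-- The weighted Fourier transform of a distributional solution is differentiable in norm. -/
theorem IsSolution.hasDerivAt_weighted {a : ℝ} {A : ℝ → L2 d} (hA : IsSolution a A) (t : ℝ) :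
    HasDerivAt (fun t => mulOp weight (𝓕 (A t)))
      ((-I) • mulOp (fun ξ => dispersion ξ * weight ξ) (𝓕 (A t))
        + (I * a) • mulOp weight (𝓕 (satL2 (A t)))) t := by
  obtain ⟨hc, dA, hdA, heq⟩ := hA
  -- Multiplying the equation by i solves it for the time derivative.
  have hdA' : ∀ t, dA t = I • Δ (toDist (A t)) + (I * a) • toDist (satL2 (A t)) := by
    intro t
    have h1 : I • (I • dA t + Δ (toDist (A t))) = I • (-((a : ℂ) • toDist (satL2 (A t)))) := by
      rw [heq t]
    rw [smul_add, smul_smul, I_mul_I, neg_one_smul, smul_neg, smul_smul] at h1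
    rw [← sub_eq_zero] at h1 ⊢
    rw [← neg_eq_zero, ← h1]
    abel
  have hcF : Continuous fun t => (𝓕 (A t) : L2 d) := continuous_fourier_L2.comp hc
  have hcN : Continuous fun t => (𝓕 (satL2 (A t)) : L2 d) :=
    continuous_fourier_L2.comp (continuous_satL2.comp hc)
  refine hasDerivAt_of_separating (V := fun t => mulOp weight (𝓕 (A t)))
    (Z := fun t => (-I) • mulOp (fun ξ => dispersion ξ * weight ξ) (𝓕 (A t))
      + (I * a) • mulOp weight (𝓕 (satL2 (A t)))) (fun φ => (testCLM φ).restrictScalars ℝ) ?_ ?_ ?_ t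
  · intro f hf
    refine toDist_injective ?_
    have h0 : toDist (0 : L2 d) = 0 := (Lp.toTemperedDistributionCLM ℂ volume 2).map_zero
    rw [h0]
    ext φ
    exact hf φ
  · exact (((mulOp _).continuous.comp hcF).const_smul (-I)).add
      (((mulOp _).continuous.comp hcN).const_smul (I * (a : ℂ)))
  · intro φ t
    have h1 := hdA t (𝓕 (SchwartzMap.smulLeftCLM ℂ weight φ))
    have h2 : dA t (𝓕 (SchwartzMap.smulLeftCLM ℂ weight φ))
        = toDist ((-I) • mulOp (fun ξ => dispersion ξ * weight ξ) (𝓕 (A t))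
          + (I * a) • mulOp weight (𝓕 (satL2 (A t)))) φ := by
      rw [toDist_weighted_velocity, ← hdA']
      rfl
    rw [h2] at h1
    simp only [← toDist_mulOp_weight_apply] at h1
    exact h1

/-- A distributional solution solves the equation in the interaction picture, in norm. -/
theorem IsSolution.hasDerivAt_profile {a : ℝ} {A : ℝ → L2 d} (hA : IsSolution a A) (t : ℝ) :
    HasDerivAt (fun t => propagator t (𝓕 (A t)))
      (profileField a t (propagator t (𝓕 (A t)))) t := by
  have hc := hA.1
  have hY := hA.hasDerivAt_weighted
  refine hasDerivAt_of_separating (ι := Unit)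
    (V := fun t => propagator t (𝓕 (A t)))
    (Z := fun t => profileField a t (propagator t (𝓕 (A t))))
    -- Two weights are needed: one makes 𝓕A differentiable, the other makes the propagator
    -- differentiable. Their product is still injective.
    (fun _ => ((mulOp weight).comp (mulOp weight)).restrictScalars ℝ) ?_ ?_ ?_ t
  · intro f hf
    have h1 := hf ()
    refine mulOp_injective bddMeas_weight weight_ne_zero
      (mulOp_injective bddMeas_weight weight_ne_zero ?_)
    rw [map_zero, map_zero]
    exact h1
  · have h1 : Continuous fun t : ℝ => (t, propagator t (𝓕 (A t))) :=
      continuous_id.prodMk (continuous_profile hc)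
    have h2 := (continuous_profileField a).comp h1
    exact h2
  · intro _ t
    have h1 := hasDerivAt_propagator_weight (hY t)
    have hcomm : ∀ {m : EuclideanSpace ℝ (Fin d) → ℂ} (_ : BddMeas m) (s : ℝ) (f : L2 d),
        propagator s (mulOp m f) = mulOp m (propagator s f) := fun hm s f =>
      mulOp_comm (bddMeas_phase s) hm f
    simp only [hcomm bddMeas_weight, map_add, map_smul, hcomm bddMeas_dispersion_mul_weight] at h1
    -- The term iω from the phase cancels the term -iω from the Laplacian; only the nonlinearity
    -- remains.
    rw [mulOp_comm bddMeas_dispersion_mul_weight bddMeas_weight, ← add_assoc, ← add_smul,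
      add_neg_cancel, zero_smul, zero_add] at h1
    rw [← map_smul, ← map_smul, ← profileField_profile] at h1
    exact h1

/-- A solution in the interaction picture gives a distributional solution. -/
theorem isSolution_of_profile {a : ℝ} {V : ℝ → L2 d}
    (hV : ∀ t, HasDerivAt V (profileField a t (V t)) t) :
    IsSolution a fun t => 𝓕⁻ (propagator (-t) (V t)) := by
  set A : ℝ → L2 d := fun t => 𝓕⁻ (propagator (-t) (V t)) with hA
  have hVc : Continuous V := continuous_iff_continuousAt.2 fun t => (hV t).continuousAt
  have hFA : ∀ t, (𝓕 (A t) : L2 d) = propagator (-t) (V t) := fun t =>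
    fourier_fourierInv_eq _
  refine ⟨continuous_fourierInv_L2.comp (continuous_propagator.comp
    (continuous_neg.prodMk hVc)),
    fun t => I • Δ (toDist (A t)) + (I * a) • toDist (satL2 (A t)), fun t φ => ?_, fun t => ?_⟩
  -- Since 1/weight has temperate growth, every test function is the Fourier transform of weight
  -- times a Schwartz function, so the weighted derivative tests against all φ.
  · set χ : 𝓢(EuclideanSpace ℝ (Fin d), ℂ) := SchwartzMap.smulLeftCLM ℂ
      (fun ξ : EuclideanSpace ℝ (Fin d) => (((1 + ‖ξ‖ ^ 2) ^ (2 : ℝ) : ℝ) : ℂ)) (𝓕⁻ φ) with hχ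
    have hφ : 𝓕 (SchwartzMap.smulLeftCLM ℂ weight χ) = φ := by
      have : SchwartzMap.smulLeftCLM ℂ weight χ = 𝓕⁻ φ := by
        ext ξ
        rw [hχ, SchwartzMap.smulLeftCLM_apply_apply hasTemperateGrowth_weight,
          SchwartzMap.smulLeftCLM_apply_apply (hasTemperateGrowth_one_add_sq_rpow 2), smul_smul,
          weight, ← ofReal_mul, ← Real.rpow_add (by positivity)]
        simp
      rw [this, fourier_fourierInv_eq]
    have h1 : HasDerivAt (fun s => mulOp weight (propagator (-s) (V s)))
        ((-I) • mulOp (fun ξ => dispersion ξ * weight ξ) (𝓕 (A t))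
          + (I * a) • mulOp weight (𝓕 (satL2 (A t)))) t := by
      -- `hasDerivAt_propagator_weight` is stated for e^{+itω}; it is applied to the reversed V at
      -- time -t and then composed with negation.
      have h2 : HasDerivAt (fun s => V (-s)) (-profileField a t (V t)) (-t) := by
        have h := (hV (- -t)).scomp (-t) (hasDerivAt_neg (-t))
        rw [neg_one_smul, neg_neg] at h
        exact h
      have h3 := (hasDerivAt_propagator_weight h2).scomp t (hasDerivAt_neg t)
      have h4 : propagator (-t) (profileField a t (V t)) = (I * a) • 𝓕 (satL2 (A t)) := by
        rw [profileField, map_smul, propagator_neg_propagator]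
      rw [neg_one_smul, neg_add, map_neg, map_neg, neg_neg, h4, map_smul, neg_neg, ← hFA,
        ← neg_smul] at h3
      refine h3.congr_of_eventuallyEq (Filter.Eventually.of_forall fun s => ?_)
      simp
    have h5 := hasDerivAt_complexCLM_comp (testCLM χ) h1
    simp only [testCLM_apply] at h5
    rw [toDist_weighted_velocity] at h5
    simp only [← hFA, toDist_mulOp_weight_apply, hφ] at h5
    exact h5.congr_deriv (congrArg (I • Δ (toDist (A t)) + (I * a) • toDist (satL2 (A t))) hφ)
  · rw [smul_add, smul_smul, I_mul_I, smul_smul, ← mul_assoc, I_mul_I, neg_one_smul, neg_mul,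
      one_mul, neg_smul]
    abel

/-- Existence of solutions in `C(ℝ; L²)`. -/
theorem exists_isSolution {a : ℝ} (ha : |a| = 1) (A₀ : L2 d) :
    ∃ A : ℝ → L2 d, IsSolution a A ∧ A 0 = A₀ := by
  obtain ⟨V, hV0, hV⟩ := exists_global_integralCurve (F := profileField (d := d) a)
    (K := ((3 : NNReal) : ℝ)) (NNReal.coe_nonneg _) (continuous_profileField a)
    (norm_profileField_sub_le ha) (profileField_zero a) (𝓕 A₀)
  refine ⟨_, isSolution_of_profile hV, ?_⟩
  simp only [neg_zero, propagator_zero, hV0, fourierInv_fourier_eq]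

/-- Lipschitz dependence of solutions on the data. -/
theorem IsSolution.norm_sub_le {a : ℝ} (ha : |a| = 1) {A B : ℝ → L2 d} (hA : IsSolution a A)
    (hB : IsSolution a B) (t : ℝ) :
    ‖A t - B t‖ ≤ ‖A 0 - B 0‖ * Real.exp (3 * |t|) := by
  have h := norm_sub_le_of_integralCurves (norm_profileField_sub_le ha)
    hA.hasDerivAt_profile hB.hasDerivAt_profile t
  simpa only [← map_sub, ← fourier_sub_L2, norm_propagator, Lp.norm_fourier_eq, NNReal.coe_ofNat] using h

theorem IsSolution.eq {a : ℝ} (ha : |a| = 1) {A B : ℝ → L2 d} (hA : IsSolution a A)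
    (hB : IsSolution a B) (h0 : A 0 = B 0) : A = B := by
  funext t
  have h := hA.norm_sub_le ha hB t
  rw [h0, sub_self, norm_zero, zero_mul] at h
  exact sub_eq_zero.1 (norm_le_zero_iff.1 h)

lemma hasDerivAt_norm_sq {u : ℝ → L2 d} {u' : L2 d} {t : ℝ} (hu : HasDerivAt u u' t) :
    HasDerivAt (fun s => ‖u s‖ ^ 2) (2 * (inner ℂ (u t) u').re) t := by
  have h := hu.inner ℂ hu
  have h2 := (Complex.reCLM.hasFDerivAt.comp_hasDerivAt t h)
  have e1 : (fun s => ‖u s‖ ^ 2) = Complex.reCLM ∘ fun s => inner ℂ (u s) (u s) := by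
    funext s
    exact norm_sq_eq_re_inner (𝕜 := ℂ) (u s)
  rw [e1]
  refine h2.congr_deriv ?_
  have h3 := inner_re_symm (𝕜 := ℂ) (u t) u'
  simp only [RCLike.re_to_complex] at h3
  rw [reCLM_apply, add_re, ← h3, two_mul]

lemma inner_fourier_satL2_im (f : L2 d) :
    (inner ℂ (𝓕 f : L2 d) (𝓕 (satL2 f) : L2 d)).im = 0 := by
  rw [Lp.inner_fourier_eq, im_inner_satL2]

/-- In the interaction picture the squared norm has derivative 2 Re(ia⟨𝓕A, 𝓕 sat A⟩), which vanishes
because the inner product is real. -/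
theorem IsSolution.norm_eq {a : ℝ} {A : ℝ → L2 d} (hA : IsSolution a A) (t : ℝ) :
    ‖A t‖ = ‖A 0‖ := by
  have h : ∀ t, HasDerivAt (fun t => ‖propagator t (𝓕 (A t))‖ ^ 2) 0 t := by
    intro t
    refine (hasDerivAt_norm_sq (hA.hasDerivAt_profile t)).congr_deriv ?_
    rw [profileField_profile, inner_smul_right, inner_propagator]
    simp [inner_fourier_satL2_im, Complex.mul_re, Complex.mul_im, -Lp.inner_fourier_eq]
  have hc := is_const_of_deriv_eq_zero (fun t => (h t).differentiableAt)
    (fun t => (h t).deriv) t 0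
  simp only [norm_propagator, Lp.norm_fourier_eq] at hc
  exact (pow_left_inj₀ (norm_nonneg _) (norm_nonneg _) two_ne_zero).1 hc

end SatNLS
end

noncomputable section

namespace SatNLS

open FourierTransform Complex Filter Topology

/-! ### Partial derivatives as Fourier multipliers -/

variable {d : ℕ}

/-- The symbol `2π ξᵢ` of `-i ∂ᵢ`. -/
def freq (i : Fin d) (ξ : EuclideanSpace ℝ (Fin d)) : ℝ := 2 * Real.pi * ξ i

/-- `g` is the image of `f` under multiplication by the symbol `i 2π ξᵢ` of `∂ᵢ`. -/
def IsFreqMul (i : Fin d) (f g : L2 d) : Prop := g =ᵐ[volume] fun ξ => I * freq i ξ * f ξ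

lemma continuous_freq (i : Fin d) : Continuous (freq i) := by
  unfold freq; fun_prop

lemma abs_freq_le (i : Fin d) (ξ : EuclideanSpace ℝ (Fin d)) :
    |freq i ξ| ≤ 2 * Real.pi * (1 + ‖ξ‖ ^ 2) := by
  have h1 : ‖ξ i‖ ≤ ‖ξ‖ := PiLp.norm_apply_le ξ i
  rw [freq, abs_mul, abs_of_pos Real.two_pi_pos, ← Real.norm_eq_abs]
  refine mul_le_mul_of_nonneg_left (h1.trans ?_) Real.two_pi_pos.le
  nlinarith [sq_nonneg (‖ξ‖ - 1)]

lemma sum_freq_sq (ξ : EuclideanSpace ℝ (Fin d)) : ∑ i, freq i ξ ^ 2 = dispersion ξ := by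
  simp only [freq, dispersion, mul_pow, ← Finset.mul_sum, EuclideanSpace.norm_sq_eq,
    Real.norm_eq_abs, sq_abs]

lemma freq_eq_inner (i : Fin d) (ξ : EuclideanSpace ℝ (Fin d)) :
    freq i ξ = 2 * Real.pi * inner ℝ ξ (EuclideanSpace.single i (1 : ℝ)) := by
  simp [freq, EuclideanSpace.inner_single_right]

lemma hasTemperateGrowth_freq (i : Fin d) :
    (fun ξ : EuclideanSpace ℝ (Fin d) => I * (freq i ξ : ℂ)).HasTemperateGrowth := by
  simp only [freq_eq_inner]; fun_prop

lemma bddMeas_freq_mul {m : EuclideanSpace ℝ (Fin d) → ℂ} (hm : Measurable m) {C : ℝ}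
    (hC : ∀ ξ, (1 + ‖ξ‖ ^ 2) * ‖m ξ‖ ≤ C) (i : Fin d) : BddMeas fun ξ => I * freq i ξ * m ξ := by
  refine ⟨(by have := (continuous_freq i).measurable; fun_prop), 2 * Real.pi * C, fun ξ => ?_⟩
  rw [norm_mul, norm_mul, norm_I, one_mul, Complex.norm_real, Real.norm_eq_abs]
  calc _ ≤ 2 * Real.pi * (1 + ‖ξ‖ ^ 2) * ‖m ξ‖ :=
        mul_le_mul_of_nonneg_right (abs_freq_le i ξ) (norm_nonneg _)
    _ = 2 * Real.pi * ((1 + ‖ξ‖ ^ 2) * ‖m ξ‖) := by ring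
    _ ≤ _ := mul_le_mul_of_nonneg_left (hC ξ) Real.two_pi_pos.le

lemma one_add_sq_mul_norm_weight_le (ξ : EuclideanSpace ℝ (Fin d)) :
    (1 + ‖ξ‖ ^ 2) * ‖weight ξ‖ ≤ 1 := by
  rw [norm_weight, ← div_eq_mul_inv, div_le_one (by positivity)]
  nlinarith [sq_nonneg ‖ξ‖, sq_nonneg (‖ξ‖ ^ 2)]

lemma bddMeas_freq_mul_weight (i : Fin d) :
    BddMeas fun ξ : EuclideanSpace ℝ (Fin d) => I * freq i ξ * weight ξ :=
  bddMeas_freq_mul measurable_weight one_add_sq_mul_norm_weight_le i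

lemma IsFreqMul.unique {i : Fin d} {f g h : L2 d} (hg : IsFreqMul i f g) (hh : IsFreqMul i f h) :
    g = h := Lp.ext (hg.trans hh.symm)

lemma IsFreqMul.mulOp {i : Fin d} {f g : L2 d} (h : IsFreqMul i f g)
    {m : EuclideanSpace ℝ (Fin d) → ℂ} (hm : BddMeas m) :
    IsFreqMul i (mulOp m f) (mulOp m g) := by
  filter_upwards [h, mulOp_ae hm f, mulOp_ae hm g] with x h1 h2 h3
  rw [h3, h2, h1]; ring

lemma IsFreqMul.mulOp_eq {i : Fin d} {f g : L2 d} (h : IsFreqMul i f g)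
    {m : EuclideanSpace ℝ (Fin d) → ℂ} (hm : BddMeas m)
    (hm' : BddMeas fun ξ => I * freq i ξ * m ξ) :
    SatNLS.mulOp (fun ξ => I * freq i ξ * m ξ) f = SatNLS.mulOp m g := by
  rw [mulOp_eq_iff hm']
  filter_upwards [h, mulOp_ae hm g] with x h1 h3
  rw [h3, h1]; ring

lemma fourier_lineDeriv_single (i : Fin d) (T : 𝓢'(EuclideanSpace ℝ (Fin d), ℂ)) :
    𝓕 (∂_{(EuclideanSpace.single i (1 : ℝ))} T)
      = TemperedDistribution.smulLeftCLM ℂ (fun ξ => I * (freq i ξ : ℂ)) (𝓕 T) := by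
  have h : (fun ξ : EuclideanSpace ℝ (Fin d) => I * (freq i ξ : ℂ)) = (2 * Real.pi * I) •
      fun ξ => ((inner ℝ ξ (EuclideanSpace.single i (1 : ℝ)) : ℝ) : ℂ) := by
    funext ξ
    rw [freq_eq_inner, Pi.smul_apply, smul_eq_mul]; push_cast; ring
  rw [h, TemperedDistribution.smulLeftCLM_smul (by fun_prop),
    TemperedDistribution.fourier_lineDerivOp_eq]
  rfl

/-- Distributional partial derivatives in `L²` are multiplications on the Fourier side. -/
lemma toDist_eq_lineDeriv_iff (i : Fin d) (f g : L2 d) :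
    toDist g = ∂_{(EuclideanSpace.single i (1 : ℝ))} (toDist f)
      ↔ IsFreqMul i (𝓕 f) (𝓕 g) := by
  have hF : ∀ f : L2 d, toDist (𝓕 f) = 𝓕 (toDist f) := fun f =>
    (Lp.fourier_toTemperedDistribution_eq f).symm
  constructor
  · intro h
    -- The symbol is unbounded, so the identity is first multiplied by the weight, compared in `L²`,
    -- and then divided pointwise.
    have h1 : toDist (mulOp weight (𝓕 g))
        = toDist (mulOp (fun ξ => I * freq i ξ * weight ξ) (𝓕 f)) := by
      rw [toDist_mulOp bddMeas_weight hasTemperateGrowth_weight,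
        toDist_mulOp (bddMeas_freq_mul_weight i)
          ((hasTemperateGrowth_freq i).mul hasTemperateGrowth_weight), hF, hF, h,
        fourier_lineDeriv_single, TemperedDistribution.smulLeftCLM_smulLeftCLM_apply
          (hasTemperateGrowth_freq i) hasTemperateGrowth_weight]
      rfl
    have h2 := toDist_injective h1
    rw [mulOp_eq_iff bddMeas_weight] at h2
    have h3 := mulOp_ae (bddMeas_freq_mul_weight i) (𝓕 f : L2 d)
    filter_upwards [h2, h3] with ξ e2 e3
    rw [e3] at e2
    refine mul_left_cancel₀ (weight_ne_zero ξ) (e2.symm.trans ?_)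
    ring
  · intro h
    have h1 : 𝓕 (toDist g) = 𝓕 (∂_{(EuclideanSpace.single i (1 : ℝ))} (toDist f)) := by
      rw [fourier_lineDeriv_single, ← hF, ← hF]
      ext φ
      rw [TemperedDistribution.smulLeftCLM_apply_apply, Lp.toTemperedDistribution_apply,
        Lp.toTemperedDistribution_apply]
      refine integral_congr_ae ?_
      filter_upwards [h] with ξ hξ
      rw [hξ, SchwartzMap.smulLeftCLM_apply_apply (hasTemperateGrowth_freq i), smul_eq_mul,
        smul_eq_mul, smul_eq_mul]
      ring
    have h2 := congrArg (fun T : 𝓢'(EuclideanSpace ℝ (Fin d), ℂ) =>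
      (𝓕⁻ T : 𝓢'(EuclideanSpace ℝ (Fin d), ℂ))) h1
    simpa only [fourierInv_fourier_eq] using h2

/-! ### Translations -/

/-- Translation of an `L²` function. -/
def translate (h : EuclideanSpace ℝ (Fin d)) (f : L2 d) : L2 d :=
  Lp.compMeasurePreserving (fun x => x + h) (measurePreserving_add_right volume h) f

lemma translate_ae (h : EuclideanSpace ℝ (Fin d)) (f : L2 d) :
    translate h f =ᵐ[volume] fun x => f (x + h) :=
  Lp.coeFn_compMeasurePreserving f (measurePreserving_add_right volume h)

lemma satL2_translate (h : EuclideanSpace ℝ (Fin d)) (f : L2 d) :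
    satL2 (translate h f) = translate h (satL2 f) := by
  refine Lp.ext ?_
  have h1 := (measurePreserving_add_right volume h).quasiMeasurePreserving.ae_eq_comp
    (coeFn_satL2 f)
  filter_upwards [coeFn_satL2 (translate h f), translate_ae h f, translate_ae h (satL2 f), h1]
    with x e1 e2 e3 e4
  rw [e1, e2, e3]
  exact e4.symm

/-- The symbol `e^{2πi s ξᵢ}` of the translation by `s` in the direction `i`. -/
def shift (i : Fin d) (s : ℝ) (ξ : EuclideanSpace ℝ (Fin d)) : ℂ := cexp ((s * freq i ξ : ℝ) * I)

lemma norm_shift (i : Fin d) (s : ℝ) (ξ : EuclideanSpace ℝ (Fin d)) : ‖shift i s ξ‖ = 1 :=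
  norm_exp_ofReal_mul_I _

lemma continuous_shift (i : Fin d) (s : ℝ) : Continuous (shift i s) := by
  have := continuous_freq i
  unfold shift; fun_prop

lemma bddMeas_shift (i : Fin d) (s : ℝ) : BddMeas (shift i s) :=
  ⟨(continuous_shift i s).measurable, 1, fun ξ => (norm_shift i s ξ).le⟩

lemma fourier_translate (i : Fin d) (s : ℝ) (f : L2 d) :
    (𝓕 (translate (s • EuclideanSpace.single i (1 : ℝ)) f) : L2 d) = mulOp (shift i s) (𝓕 f) := by
  set h : EuclideanSpace ℝ (Fin d) := s • EuclideanSpace.single i (1 : ℝ) with hh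
  refine DenseRange.induction_on (p := fun f : L2 d => (𝓕 (translate h f) : L2 d)
    = mulOp (shift i s) (𝓕 f))
    (SchwartzMap.denseRange_toLpCLM (F := ℂ) (p := 2) ENNReal.ofNat_ne_top) f ?_ ?_
  · refine isClosed_eq (continuous_fourier_L2.comp ?_)
      ((mulOp _).continuous.comp continuous_fourier_L2)
    exact (Lp.isometry_compMeasurePreserving (measurePreserving_add_right volume h)).continuous
  · intro φ
    have hg : (fun x : EuclideanSpace ℝ (Fin d) => x + h).HasTemperateGrowth := by fun_prop
    have hanti : AntilipschitzWith 1 fun x : EuclideanSpace ℝ (Fin d) => x + h :=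
      (isometry_add_right h).antilipschitz
    set ψ : 𝓢(EuclideanSpace ℝ (Fin d), ℂ) :=
      SchwartzMap.compCLMOfAntilipschitz ℂ hg hanti φ with hψ
    have h1 : translate h (φ.toLp 2) = ψ.toLp 2 := by
      refine Lp.ext ?_
      have e := (measurePreserving_add_right volume h).quasiMeasurePreserving.ae_eq_comp
        (φ.coeFn_toLp 2 volume)
      filter_upwards [translate_ae h (φ.toLp 2), ψ.coeFn_toLp 2 volume, e] with x e1 e2 e3
      rw [e1, e2]
      exact e3
    change (𝓕 (translate h (φ.toLp 2)) : L2 d) = mulOp (shift i s) (𝓕 (φ.toLp 2))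
    rw [h1, SchwartzMap.toLp_fourier_eq, SchwartzMap.toLp_fourier_eq, eq_comm,
      mulOp_eq_iff (bddMeas_shift i s)]
    filter_upwards [(𝓕 ψ).coeFn_toLp 2 volume, (𝓕 φ).coeFn_toLp 2 volume] with ξ e1 e2
    rw [e1, e2, SchwartzMap.fourier_coe, SchwartzMap.fourier_coe]
    have h2 := congrFun (VectorFourier.fourierIntegral_comp_add_right Real.fourierChar volume
      (innerₗ (EuclideanSpace ℝ (Fin d))) φ h) ξ
    have h3 : (Real.fourierChar (innerₗ (EuclideanSpace ℝ (Fin d)) h ξ) : ℂ) = shift i s ξ := by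
      rw [Real.fourierChar_apply, shift, freq_eq_inner, hh]
      simp only [innerₗ_apply_apply, inner_smul_left, real_inner_comm]
      congr 2
      simp
      ring
    rw [← h3]
    exact h2

lemma satL2_shift (i : Fin d) (s : ℝ) (f : L2 d) :
    (𝓕 (satL2 (𝓕⁻ (mulOp (shift i s) (𝓕 f) : L2 d))) : L2 d)
      = mulOp (shift i s) (𝓕 (satL2 f)) := by
  rw [← fourier_translate, fourierInv_fourier_eq, satL2_translate, fourier_translate]

/-- Translations commute with the nonlinearity, so its Lipschitz bound compares difference
quotients; this replaces the chain rule. -/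
lemma norm_shift_satL2_sub_le (i : Fin d) (s : ℝ) (f : L2 d) :
    ‖mulOp (shift i s) (𝓕 (satL2 f)) - 𝓕 (satL2 f)‖
      ≤ 3 * ‖mulOp (shift i s) (𝓕 f) - 𝓕 f‖ := by
  rw [← fourier_translate, ← fourier_translate, ← fourier_sub_L2, ← fourier_sub_L2,
    Lp.norm_fourier_eq, Lp.norm_fourier_eq, ← satL2_translate]
  exact norm_satL2_sub_le _ _

lemma IsFreqMul.norm_shift_sub_le {i : Fin d} {f g : L2 d} (h : IsFreqMul i f g) (s : ℝ) :
    ‖SatNLS.mulOp (shift i s) f - f‖ ≤ |s| * ‖g‖ := by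
  refine Lp.norm_le_mul_norm_of_ae_le_mul ?_
  filter_upwards [h, mulOp_ae (bddMeas_shift i s) f, Lp.coeFn_sub (SatNLS.mulOp (shift i s) f) f]
    with ξ h1 h2 h3
  rw [h3, Pi.sub_apply, h2, h1, ← sub_one_mul, norm_mul, norm_mul, norm_mul, norm_I, one_mul,
    ← mul_assoc]
  refine mul_le_mul_of_nonneg_right ?_ (norm_nonneg _)
  have := Real.norm_exp_I_mul_ofReal_sub_one_le (x := s * freq i ξ)
  rw [shift, mul_comm _ I]
  refine this.trans ?_
  rw [norm_mul, Complex.norm_real]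
  rfl

/-- The difference quotients with step 1/(n+1) have bounded symbols converging pointwise to that of
∂ᵢ; Fatou gives the derivative with the same bound C. -/
lemma exists_isFreqMul_of_norm_shift_sub_le {i : Fin d} {f : L2 d} {C : ℝ}
    (h : ∀ s, ‖mulOp (shift i s) f - f‖ ≤ |s| * C) : ∃ g, IsFreqMul i f g ∧ ‖g‖ ≤ C := by
  have hb : ∀ n : ℕ, BddMeas fun ξ => ((n : ℂ) + 1) * (shift i (1 / ((n : ℝ) + 1)) ξ - 1) := fun n =>
    ((bddMeas_shift i _).sub (BddMeas.const 1)).const_mul _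
  refine exists_ae_eq_mul_of_norm_le hb (fun ξ => ?_) (fun n => ?_)
  · have h1 : HasDerivAt (fun s : ℝ => shift i s ξ) (I * freq i ξ) 0 := by
      have h2 : HasDerivAt (fun s : ℝ => ((s * freq i ξ : ℝ) : ℂ) * I) (freq i ξ * I) 0 := by
        have := ((hasDerivAt_id (0 : ℝ)).mul_const (freq i ξ)).ofReal_comp.mul_const I
        simpa using this
      have h3 := h2.cexp
      simp only [zero_mul, ofReal_zero, Complex.exp_zero, one_mul] at h3
      rw [mul_comm I]
      exact h3
    have h2 := h1.tendsto_slope_zero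
    have h3 : Tendsto (fun n : ℕ => 1 / ((n : ℝ) + 1)) atTop (𝓝[≠] 0) :=
      tendsto_nhdsWithin_iff.2 ⟨tendsto_one_div_add_atTop_nhds_zero_nat,
        Eventually.of_forall fun n => by
          have : (0 : ℝ) < 1 / ((n : ℝ) + 1) := by positivity
          exact this.ne'⟩
    refine (h2.comp h3).congr fun n => ?_
    have h0 : shift i 0 ξ = 1 := by simp [shift]
    simp only [Function.comp_apply, zero_add, h0, real_smul]
    congr 1
    push_cast
    simp
  · rw [mulOp_const_mul ((bddMeas_shift i _).sub (BddMeas.const 1)),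
      mulOp_sub (bddMeas_shift i _) (BddMeas.const 1), _root_.smul_apply, _root_.sub_apply, mulOp_one,
      norm_smul]
    have h1 := h (1 / ((n : ℝ) + 1))
    have h2 : (0 : ℝ) < (n : ℝ) + 1 := by positivity
    have h3 : ‖(n : ℂ) + 1‖ = (n : ℝ) + 1 := by
      rw [← Nat.cast_succ, Complex.norm_natCast]; push_cast; rfl
    rw [h3]
    rw [abs_of_pos (by positivity), div_mul_eq_mul_div, one_mul, le_div_iff₀ h2] at h1
    linarith

/-- The nonlinearity is bounded on `H¹`. -/
lemma IsFreqMul.exists_satL2 {i : Fin d} {f g : L2 d} (h : IsFreqMul i (𝓕 f) g) :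
    ∃ g', IsFreqMul i (𝓕 (satL2 f)) g' ∧ ‖g'‖ ≤ 3 * ‖g‖ :=
  exists_isFreqMul_of_norm_shift_sub_le fun s => by
    refine (norm_shift_satL2_sub_le i s f).trans ?_
    have := h.norm_shift_sub_le s
    linarith

lemma profileField_shift (a t : ℝ) (i : Fin d) (s : ℝ) (v : L2 d) :
    profileField a t (mulOp (shift i s) v) = mulOp (shift i s) (profileField a t v) := by
  have h1 : propagator (-t) (mulOp (shift i s) v)
      = mulOp (shift i s) (𝓕 (𝓕⁻ (propagator (-t) v) : L2 d)) := by
    rw [fourier_fourierInv_eq]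
    exact mulOp_comm (bddMeas_phase _) (bddMeas_shift i s) v
  rw [profileField, h1, satL2_shift, profileField, map_smul]
  congr 1
  exact mulOp_comm (bddMeas_phase _) (bddMeas_shift i s) _

/-- The shifted profile is an integral curve of the same field, so Grönwall controls its distance to
the original. -/
lemma IsSolution.norm_shift_sub_le {a : ℝ} (ha : |a| = 1) {A : ℝ → L2 d} (hA : IsSolution a A)
    (i : Fin d) (s t : ℝ) :
    ‖mulOp (shift i s) (𝓕 (A t)) - 𝓕 (A t)‖
      ≤ ‖mulOp (shift i s) (𝓕 (A 0)) - 𝓕 (A 0)‖ * Real.exp (3 * |t|) := by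
  have hV := hA.hasDerivAt_profile
  have hS : ∀ t, HasDerivAt (fun t => mulOp (shift i s) (propagator t (𝓕 (A t))))
      (profileField a t (mulOp (shift i s) (propagator t (𝓕 (A t))))) t := fun t => by
    rw [profileField_shift]
    exact hasDerivAt_complexCLM_comp _ (hV t)
  have h := norm_sub_le_of_integralCurves (norm_profileField_sub_le ha) hS hV t
  have hcomm : ∀ t (f : L2 d), mulOp (shift i s) (propagator t f)
      = propagator t (mulOp (shift i s) f) := fun t f =>
    mulOp_comm (bddMeas_shift i s) (bddMeas_phase t) f
  simpa only [hcomm, ← map_sub, norm_propagator, NNReal.coe_ofNat] using h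

/-- Propagation of `H¹` regularity. -/
lemma IsSolution.exists_isFreqMul {a : ℝ} (ha : |a| = 1) {A : ℝ → L2 d} (hA : IsSolution a A)
    {i : Fin d} {g₀ : L2 d} (h : IsFreqMul i (𝓕 (A 0)) g₀) (t : ℝ) :
    ∃ g, IsFreqMul i (𝓕 (A t)) g ∧ ‖g‖ ≤ ‖g₀‖ * Real.exp (3 * |t|) :=
  exists_isFreqMul_of_norm_shift_sub_le fun s => by
    refine (hA.norm_shift_sub_le ha i s t).trans ?_
    rw [← mul_assoc]
    exact mul_le_mul_of_nonneg_right (h.norm_shift_sub_le s) (Real.exp_pos _).le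

/-! ### Regularization and the regularized energy -/

/-- The regularizing symbol `(1 + |ξ|² / (n + 1))⁻¹`. -/
def cutoff (n : ℕ) (ξ : EuclideanSpace ℝ (Fin d)) : ℂ := (((1 + ‖ξ‖ ^ 2 / (n + 1))⁻¹ : ℝ) : ℂ)

lemma cutoff_pos (n : ℕ) (ξ : EuclideanSpace ℝ (Fin d)) :
    (0 : ℝ) < (1 + ‖ξ‖ ^ 2 / (n + 1))⁻¹ := by positivity

lemma norm_cutoff (n : ℕ) (ξ : EuclideanSpace ℝ (Fin d)) :
    ‖cutoff n ξ‖ = (1 + ‖ξ‖ ^ 2 / (n + 1))⁻¹ := by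
  rw [cutoff, Complex.norm_real, Real.norm_of_nonneg (cutoff_pos n ξ).le]

lemma norm_cutoff_le (n : ℕ) (ξ : EuclideanSpace ℝ (Fin d)) : ‖cutoff n ξ‖ ≤ 1 := by
  rw [norm_cutoff]
  refine inv_le_one_of_one_le₀ ?_
  have : (0 : ℝ) ≤ ‖ξ‖ ^ 2 / (n + 1) := by positivity
  linarith

lemma measurable_cutoff (n : ℕ) : Measurable (cutoff n : EuclideanSpace ℝ (Fin d) → ℂ) := by
  unfold cutoff; fun_prop

lemma bddMeas_cutoff (n : ℕ) : BddMeas (cutoff n : EuclideanSpace ℝ (Fin d) → ℂ) :=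
  ⟨measurable_cutoff n, 1, norm_cutoff_le n⟩

lemma one_add_sq_mul_norm_cutoff_le (n : ℕ) (ξ : EuclideanSpace ℝ (Fin d)) :
    (1 + ‖ξ‖ ^ 2) * ‖cutoff n ξ‖ ≤ n + 1 := by
  rw [norm_cutoff, ← div_eq_mul_inv, div_le_iff₀ (by positivity)]
  have h : ((n : ℝ) + 1) * (1 + ‖ξ‖ ^ 2 / (n + 1)) = n + 1 + ‖ξ‖ ^ 2 := by field_simp
  rw [h]
  have : (0 : ℝ) ≤ n := Nat.cast_nonneg n
  linarith

lemma tendsto_cutoff (ξ : EuclideanSpace ℝ (Fin d)) :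
    Tendsto (fun n => cutoff n ξ) atTop (𝓝 1) := by
  have h1 : Tendsto (fun n : ℕ => ‖ξ‖ ^ 2 / ((n : ℝ) + 1)) atTop (𝓝 0) := by
    have := (tendsto_one_div_add_atTop_nhds_zero_nat (𝕜 := ℝ)).const_mul (‖ξ‖ ^ 2)
    simpa [div_eq_mul_inv] using this
  have h2 : Tendsto (fun n : ℕ => (1 + ‖ξ‖ ^ 2 / ((n : ℝ) + 1))⁻¹) atTop (𝓝 1) := by
    simpa using (h1.const_add 1).inv₀ (by norm_num)
  have h3 := (continuous_ofReal.tendsto _).comp h2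
  rw [ofReal_one] at h3
  exact h3

lemma bddMeas_freq_mul_cutoff (i : Fin d) (n : ℕ) :
    BddMeas fun ξ : EuclideanSpace ℝ (Fin d) => I * freq i ξ * cutoff n ξ :=
  bddMeas_freq_mul (measurable_cutoff n) (one_add_sq_mul_norm_cutoff_le n) i

/-- The regularizing Fourier multiplier. -/
def smoothing (n : ℕ) : L2 d →L[ℂ] L2 d := mulOp (cutoff n)

lemma norm_smoothing_le (n : ℕ) (f : L2 d) : ‖smoothing n f‖ ≤ ‖f‖ := by
  have h := norm_mulOp_apply_le (measurable_cutoff n) (norm_cutoff_le n) f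
  rwa [one_mul] at h

lemma tendsto_smoothing {f : ℕ → L2 d} {f₀ : L2 d} (hf : Tendsto f atTop (𝓝 f₀)) :
    Tendsto (fun n => smoothing n (f n)) atTop (𝓝 f₀) := by
  have h1 : Tendsto (fun n => smoothing n f₀) atTop (𝓝 f₀) := by
    have := tendsto_mulOp (l := atTop) (C := 1) measurable_cutoff norm_cutoff_le (BddMeas.const 1)
      tendsto_cutoff f₀
    rwa [mulOp_one] at this
  have h2 : Tendsto (fun n => smoothing n (f n - f₀)) atTop (𝓝 0) := by
    refine squeeze_zero_norm (fun n => norm_smoothing_le n _) ?_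
    exact tendsto_iff_norm_sub_tendsto_zero.1 hf
  have h3 := h2.add h1
  rw [zero_add] at h3
  refine h3.congr fun n => ?_
  rw [← map_add, sub_add_cancel]

lemma inner_smoothing_left (n : ℕ) (f g : L2 d) :
    inner ℂ (smoothing n f) g = inner ℂ f (smoothing n g) := by
  rw [smoothing, inner_mulOp_left (bddMeas_cutoff n)]
  simp only [cutoff, conj_ofReal]
  rfl

lemma smoothing_propagator (n : ℕ) (t : ℝ) (f : L2 d) :
    smoothing n (propagator t f) = propagator t (smoothing n f) :=
  mulOp_comm (bddMeas_cutoff n) (bddMeas_phase t) f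

/-- The symbol `(1 + |ξ|²)²` times the square of the regularizing symbol. -/
def weightedCutoff (n : ℕ) (ξ : EuclideanSpace ℝ (Fin d)) : ℂ :=
  ((1 + ‖ξ‖ ^ 2 : ℝ) : ℂ) * cutoff n ξ * (((1 + ‖ξ‖ ^ 2 : ℝ) : ℂ) * cutoff n ξ)

lemma bddMeas_weightedCutoff (n : ℕ) :
    BddMeas (weightedCutoff n : EuclideanSpace ℝ (Fin d) → ℂ) := by
  have h : BddMeas fun ξ : EuclideanSpace ℝ (Fin d) => ((1 + ‖ξ‖ ^ 2 : ℝ) : ℂ) * cutoff n ξ := by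
    refine ⟨by have := measurable_cutoff (d := d) n; fun_prop, n + 1, fun ξ => ?_⟩
    rw [norm_mul, Complex.norm_real, Real.norm_of_nonneg (by positivity)]
    exact one_add_sq_mul_norm_cutoff_le n ξ
  exact h.mul h

/-- The squared cutoff decays like the weight, so it factors through it with a bounded quotient.
Regularized solutions therefore inherit differentiability from `IsSolution.hasDerivAt_weighted`. -/
lemma weightedCutoff_mul_weight (n : ℕ) (ξ : EuclideanSpace ℝ (Fin d)) :
    weightedCutoff n ξ * weight ξ = cutoff n ξ * cutoff n ξ := by
  have h : ((1 + ‖ξ‖ ^ 2 : ℝ) : ℂ) ≠ 0 := by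
    exact_mod_cast (by positivity : (1 + ‖ξ‖ ^ 2 : ℝ) ≠ 0)
  rw [weightedCutoff, weight_eq, ofReal_inv, ofReal_pow]
  field_simp

lemma bddMeas_dispersion_cutoff (n : ℕ) : BddMeas fun ξ : EuclideanSpace ℝ (Fin d) =>
    (dispersion ξ : ℂ) * (cutoff n ξ * cutoff n ξ) := by
  have h := bddMeas_dispersion_mul_weight.mul (bddMeas_weightedCutoff (d := d) n)
  refine (congrArg BddMeas (funext fun ξ => ?_)).mp h
  rw [← weightedCutoff_mul_weight]; ring

/-- The regularized Laplacian on the Fourier side. -/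
def smoothedDispersion (n : ℕ) : L2 d →L[ℂ] L2 d :=
  mulOp fun ξ => (dispersion ξ : ℂ) * (cutoff n ξ * cutoff n ξ)

/-- Integration by parts on the Fourier side, from ω = Σ (2πξᵢ)²; each factor receives one of the
two cutoffs. -/
lemma inner_smoothedDispersion (n : ℕ) {f g : L2 d} {D K : Fin d → L2 d}
    (hD : ∀ i, IsFreqMul i f (D i)) (hK : ∀ i, IsFreqMul i g (K i)) :
    inner ℂ g (smoothedDispersion n f)
      = ∑ i, inner ℂ (smoothing n (K i)) (smoothing n (D i)) := by
  simp only [L2.inner_def]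
  rw [← integral_finsetSum _ fun i _ => L2.integrable_inner _ _]
  refine integral_congr_ae ?_
  have h1 : ∀ᵐ ξ ∂volume, ∀ i, D i ξ = I * freq i ξ * f ξ := ae_all_iff.2 hD
  have h2 : ∀ᵐ ξ ∂volume, ∀ i, K i ξ = I * freq i ξ * g ξ := ae_all_iff.2 hK
  have h3 : ∀ᵐ ξ ∂volume, ∀ i, smoothing n (D i) ξ = cutoff n ξ * D i ξ :=
    ae_all_iff.2 fun i => mulOp_ae (bddMeas_cutoff n) (D i)
  have h4 : ∀ᵐ ξ ∂volume, ∀ i, smoothing n (K i) ξ = cutoff n ξ * K i ξ :=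
    ae_all_iff.2 fun i => mulOp_ae (bddMeas_cutoff n) (K i)
  filter_upwards [h1, h2, h3, h4, mulOp_ae (bddMeas_dispersion_cutoff n) f]
    with ξ e1 e2 e3 e4 e5
  have e6 : ∀ i, inner ℂ (smoothing n (K i) ξ) (smoothing n (D i) ξ)
      = ((freq i ξ ^ 2 : ℝ) : ℂ) * (cutoff n ξ * cutoff n ξ * inner ℂ (g ξ) (f ξ)) := by
    intro i
    rw [e3, e4, e1, e2]
    simp only [RCLike.inner_apply, map_mul, conj_I, conj_ofReal, cutoff]
    push_cast
    linear_combination (-(freq i ξ : ℂ) ^ 2 * (((1 + (‖ξ‖ : ℂ) ^ 2 / (n + 1))⁻¹) ^ 2)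
      * (f ξ) * (starRingEnd ℂ) (g ξ)) * I_sq
  simp only [e6]
  rw [← Finset.sum_mul, ← ofReal_sum, sum_freq_sq, smoothedDispersion, e5]
  simp only [RCLike.inner_apply]
  ring

/-- The regularization of an `L²` function. -/
def mollify (n : ℕ) (f : L2 d) : L2 d := 𝓕⁻ (smoothing n (smoothing n (𝓕 f)) : L2 d)

lemma fourier_mollify (n : ℕ) (f : L2 d) :
    (𝓕 (mollify n f) : L2 d) = smoothing n (smoothing n (𝓕 f)) := fourier_fourierInv_eq _

lemma continuous_mollify (n : ℕ) : Continuous (mollify (d := d) n) :=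
  continuous_fourierInv_L2.comp ((smoothing n).continuous.comp
    ((smoothing n).continuous.comp continuous_fourier_L2))

lemma tendsto_mollify (f : L2 d) : Tendsto (fun n => mollify n f) atTop (𝓝 f) := by
  have h := tendsto_smoothing (tendsto_smoothing
    (tendsto_const_nhds (x := (𝓕 f : L2 d)) (f := (atTop : Filter ℕ))))
  have h2 := (continuous_fourierInv_L2.tendsto _).comp h
  rw [fourierInv_fourier_eq] at h2
  exact h2

lemma norm_mollify_le (n : ℕ) (f : L2 d) : ‖mollify n f‖ ≤ ‖f‖ := by
  rw [mollify, norm_fourierInv_eq, ← Lp.norm_fourier_eq f]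
  exact (norm_smoothing_le n _).trans (norm_smoothing_le n _)

/-- The time derivative of the mollified solution. -/
def mollifiedVelocity (a : ℝ) (n : ℕ) (f : L2 d) : L2 d :=
  𝓕⁻ ((-I) • smoothedDispersion n (𝓕 f)
    + (I * a) • smoothing n (smoothing n (𝓕 (satL2 f))) : L2 d)

lemma continuous_mollifiedVelocity (a : ℝ) (n : ℕ) :
    Continuous (mollifiedVelocity (d := d) a n) := by
  have h1 : Continuous fun f : L2 d => smoothedDispersion n (𝓕 f) :=
    (smoothedDispersion n).continuous.comp continuous_fourier_L2
  have h2 : Continuous fun f : L2 d => smoothing n (smoothing n (𝓕 (satL2 f))) :=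
    (smoothing n).continuous.comp ((smoothing n).continuous.comp
      (continuous_fourier_L2.comp continuous_satL2))
  exact continuous_fourierInv_L2.comp ((h1.const_smul (-I)).add (h2.const_smul (I * (a : ℂ))))

lemma IsSolution.hasDerivAt_mollify {a : ℝ} {A : ℝ → L2 d} (hA : IsSolution a A) (n : ℕ) (t : ℝ) :
    HasDerivAt (fun t => mollify n (A t)) (mollifiedVelocity a n (A t)) t := by
  have h1 := hasDerivAt_complexCLM_comp (mulOp (weightedCutoff n))
    (hA.hasDerivAt_weighted t)
  have e1 : ∀ f : L2 d, mulOp (weightedCutoff n) (mulOp weight f)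
      = smoothing n (smoothing n f) := fun f => by
    rw [mulOp_mulOp (bddMeas_weightedCutoff n) bddMeas_weight, smoothing,
      mulOp_mulOp (bddMeas_cutoff n) (bddMeas_cutoff n)]
    simp only [weightedCutoff_mul_weight]
  have e2 : ∀ f : L2 d, mulOp (weightedCutoff n) (mulOp (fun ξ => dispersion ξ * weight ξ) f)
      = smoothedDispersion n f := fun f => by
    rw [mulOp_mulOp (bddMeas_weightedCutoff n) bddMeas_dispersion_mul_weight, smoothedDispersion]
    simp only [mul_left_comm (weightedCutoff n _), weightedCutoff_mul_weight]
  simp only [map_add, map_smul, e1, e2] at h1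
  exact hasDerivAt_complexCLM_comp
    ((Lp.fourierTransformₗᵢ (EuclideanSpace ℝ (Fin d)) ℂ).symm.toContinuousLinearEquiv :
      L2 d →L[ℂ] L2 d) h1

/-- The regularized derivative on the Fourier side. -/
def smoothedDeriv (n : ℕ) (i : Fin d) : L2 d →L[ℂ] L2 d :=
  mulOp fun ξ => I * freq i ξ * cutoff n ξ

lemma IsFreqMul.smoothedDeriv {i : Fin d} {f g : L2 d} (h : IsFreqMul i f g) (n : ℕ) :
    SatNLS.smoothedDeriv n i f = smoothing n g :=
  h.mulOp_eq (bddMeas_cutoff n) (bddMeas_freq_mul_cutoff i n)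

lemma smoothedDeriv_propagator (n : ℕ) (i : Fin d) (t : ℝ) (f : L2 d) :
    smoothedDeriv n i (propagator t f) = propagator t (smoothedDeriv n i f) :=
  mulOp_comm (bddMeas_freq_mul_cutoff i n) (bddMeas_phase t) f

/-- The regularized energy. -/
def regularEnergy (a : ℝ) (n : ℕ) (f : L2 d) : ℝ :=
  ∑ i, ‖smoothedDeriv n i (𝓕 f)‖ ^ 2 - a * potentialEnergy (mollify n f)

/-- The time derivative of the regularized energy. -/
def energyRate (a : ℝ) (n : ℕ) (f : L2 d) : ℝ :=
  ∑ i, 2 * (inner ℂ (smoothedDeriv n i (𝓕 f)) ((I * a) • smoothedDeriv n i (𝓕 (satL2 f)))).re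
    - a * (2 * (inner ℂ (satL2 (mollify n f)) (mollifiedVelocity a n f)).re)

lemma continuous_energyRate (a : ℝ) (n : ℕ) : Continuous (energyRate (d := d) a n) := by
  have h1 : ∀ i, Continuous fun f : L2 d => smoothedDeriv n i (𝓕 f) := fun i =>
    (smoothedDeriv n i).continuous.comp continuous_fourier_L2
  have h2 : ∀ i, Continuous fun f : L2 d => (I * (a : ℂ)) • smoothedDeriv n i (𝓕 (satL2 f)) :=
    fun i => ((h1 i).comp continuous_satL2).const_smul (I * (a : ℂ))
  refine (continuous_finsetSum _ fun i _ => ?_).sub ?_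
  · exact continuous_const.mul (continuous_re.comp ((h1 i).inner (h2 i)))
  · exact continuous_const.mul (continuous_const.mul (continuous_re.comp
      ((continuous_satL2.comp (continuous_mollify n)).inner (continuous_mollifiedVelocity a n))))

lemma IsSolution.hasDerivAt_regularEnergy {a : ℝ} {A : ℝ → L2 d} (hA : IsSolution a A) (n : ℕ)
    (t : ℝ) :
    HasDerivAt (fun t => regularEnergy a n (A t)) (energyRate a n (A t)) t := by
  have h1 : ∀ i, HasDerivAt (fun t => ‖smoothedDeriv n i (𝓕 (A t))‖ ^ 2)
      (2 * (inner ℂ (smoothedDeriv n i (𝓕 (A t)))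
        ((I * a) • smoothedDeriv n i (𝓕 (satL2 (A t))))).re) t := by
    intro i
    -- Passing to the profile does not change the norm, since the regularized derivative commutes
    -- with the unitary propagator; the dispersive term therefore never appears.
    have h2 := hasDerivAt_norm_sq (hasDerivAt_complexCLM_comp (smoothedDeriv n i)
      (hA.hasDerivAt_profile t))
    rw [profileField_profile, ← map_smul (propagator t), smoothedDeriv_propagator,
      smoothedDeriv_propagator, inner_propagator, map_smul] at h2
    simp only [smoothedDeriv_propagator, norm_propagator] at h2
    exact h2
  have h3 := hasDerivAt_potentialEnergy (hA.hasDerivAt_mollify n t)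
  exact (HasDerivAt.fun_sum fun i _ => h1 i).sub (h3.const_mul a)

/-- D, H and K are the gradients of f, sat f and sat(mollified f). If K equalled H, the sum would be
real and its term would vanish; the last inner product likewise becomes a squared norm in the limit.
-/
lemma energyRate_eq {a : ℝ} {n : ℕ} {f : L2 d} {D H K : Fin d → L2 d}
    (hD : ∀ i, IsFreqMul i (𝓕 f) (D i)) (hH : ∀ i, IsFreqMul i (𝓕 (satL2 f)) (H i))
    (hK : ∀ i, IsFreqMul i (𝓕 (satL2 (mollify n f))) (K i)) :
    energyRate a n f = 2 * a * (I * ∑ i, (inner ℂ (smoothing n (D i)) (smoothing n (H i))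
        + inner ℂ (smoothing n (K i)) (smoothing n (D i)))).re
      - 2 * a ^ 2 * (I * inner ℂ (𝓕 (satL2 (mollify n f)) : L2 d)
        (smoothing n (smoothing n (𝓕 (satL2 f))))).re := by
  have h1 : ∀ i, 2 * (inner ℂ (smoothedDeriv n i (𝓕 f))
      ((I * a) • smoothedDeriv n i (𝓕 (satL2 f)))).re
      = 2 * a * (I * inner ℂ (smoothing n (D i)) (smoothing n (H i))).re := fun i => by
    rw [(hD i).smoothedDeriv, (hH i).smoothedDeriv, inner_smul_right,
      show I * (a : ℂ) * inner ℂ (smoothing n (D i)) (smoothing n (H i))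
        = (a : ℂ) * (I * inner ℂ (smoothing n (D i)) (smoothing n (H i))) by ring,
      re_ofReal_mul]
    ring
  have h2 : (inner ℂ (satL2 (mollify n f)) (mollifiedVelocity a n f))
      = -(I * ∑ i, inner ℂ (smoothing n (K i)) (smoothing n (D i)))
        + a * (I * inner ℂ (𝓕 (satL2 (mollify n f)) : L2 d)
        (smoothing n (smoothing n (𝓕 (satL2 f))))) := by
    rw [← Lp.inner_fourier_eq, mollifiedVelocity, fourier_fourierInv_eq, inner_add_right,
      inner_smul_right, inner_smul_right, inner_smoothedDispersion n hD hK]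
    ring
  rw [energyRate, h2, Finset.sum_congr rfl fun i _ => h1 i, ← Finset.mul_sum, ← re_sum,
    ← Finset.mul_sum, Finset.sum_add_distrib, mul_add, add_re, add_re, re_ofReal_mul, neg_re]
  ring

lemma exists_isFreqMul_satL2_mollify {f : L2 d} {D : Fin d → L2 d}
    (hD : ∀ i, IsFreqMul i (𝓕 f) (D i)) (n : ℕ) :
    ∃ K : Fin d → L2 d, ∀ i, IsFreqMul i (𝓕 (satL2 (mollify n f))) (K i) ∧
      ‖K i‖ ≤ 3 * ‖D i‖ := by
  have h : ∀ i, ∃ g, IsFreqMul i (𝓕 (satL2 (mollify n f))) g ∧ ‖g‖ ≤ 3 * ‖D i‖ := by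
    intro i
    have h1 : IsFreqMul i (𝓕 (mollify n f)) (smoothing n (smoothing n (D i))) := by
      rw [fourier_mollify]
      exact ((hD i).mulOp (bddMeas_cutoff n)).mulOp (bddMeas_cutoff n)
    obtain ⟨g, hg, hg2⟩ := h1.exists_satL2
    refine ⟨g, hg, hg2.trans ?_⟩
    have := (norm_smoothing_le n (smoothing n (D i))).trans (norm_smoothing_le n (D i))
    linarith
  choose K hK using h
  exact ⟨K, hK⟩

/-- A bound independent of n, serving as the dominating function in time. -/
lemma abs_energyRate_le {a : ℝ} (ha : |a| = 1) (n : ℕ) {f : L2 d} {D : Fin d → L2 d}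
    (hD : ∀ i, IsFreqMul i (𝓕 f) (D i)) :
    |energyRate a n f| ≤ 12 * ∑ i, ‖D i‖ ^ 2 + 2 * ‖f‖ ^ 2 := by
  obtain ⟨K, hK⟩ := exists_isFreqMul_satL2_mollify hD n
  have hH : ∀ i, ∃ g, IsFreqMul i (𝓕 (satL2 f)) g ∧ ‖g‖ ≤ 3 * ‖D i‖ := fun i =>
    (hD i).exists_satL2
  choose H hH using hH
  rw [energyRate_eq hD (fun i => (hH i).1) (fun i => (hK i).1)]
  have ha2 : a ^ 2 = 1 := by rw [← sq_abs, ha, one_pow]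
  have h1 : ∀ z : ℂ, |(I * z).re| ≤ ‖z‖ := fun z => (abs_re_le_norm _).trans (by simp)
  have h2 : ∀ i, ‖inner ℂ (smoothing n (D i)) (smoothing n (H i))
      + inner ℂ (smoothing n (K i)) (smoothing n (D i))‖ ≤ 6 * ‖D i‖ ^ 2 := by
    intro i
    have e1 : ‖inner ℂ (smoothing n (D i)) (smoothing n (H i))‖ ≤ ‖D i‖ * (3 * ‖D i‖) :=
      (norm_inner_le_norm _ _).trans (mul_le_mul (norm_smoothing_le _ _)
        ((norm_smoothing_le _ _).trans (hH i).2) (norm_nonneg _) (norm_nonneg _))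
    have e2 : ‖inner ℂ (smoothing n (K i)) (smoothing n (D i))‖ ≤ (3 * ‖D i‖) * ‖D i‖ :=
      (norm_inner_le_norm _ _).trans (mul_le_mul ((norm_smoothing_le _ _).trans (hK i).2)
        (norm_smoothing_le _ _) (norm_nonneg _) (by positivity))
    refine (norm_add_le _ _).trans ?_
    nlinarith
  have h3 : ‖inner ℂ (𝓕 (satL2 (mollify n f)) : L2 d) (smoothing n (smoothing n (𝓕 (satL2 f))))‖
      ≤ ‖f‖ * ‖f‖ := by
    refine (norm_inner_le_norm _ _).trans (mul_le_mul ?_ ?_ (norm_nonneg _) (norm_nonneg _))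
    · rw [Lp.norm_fourier_eq]
      exact (norm_satL2_le _).trans (norm_mollify_le n f)
    · refine (norm_smoothing_le _ _).trans ((norm_smoothing_le _ _).trans ?_)
      rw [Lp.norm_fourier_eq]
      exact norm_satL2_le f
  have h4 := (h1 _).trans (norm_sum_le_of_le Finset.univ fun i _ => h2 i)
  rw [← Finset.mul_sum] at h4
  have h5 := (h1 _).trans h3
  rw [ha2]
  refine (abs_sub _ _).trans ?_
  simp only [abs_mul, abs_two, ha, mul_one]
  nlinarith

/-- Bounded sequences converging weakly against a set of vectors, and its closure. -/
lemma tendsto_inner_of_weak {X : Type*} [NormedAddCommGroup X] [InnerProductSpace ℂ X]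
    {k : ℕ → X} {h y : X} {z w : ℕ → X} {C : ℝ} (hk : ∀ n, ‖k n‖ ≤ C)
    (hz : Tendsto z atTop (𝓝 y)) (hw : Tendsto w atTop (𝓝 y))
    (hkz : ∀ m, Tendsto (fun n => (inner ℂ (k n) (z m) : ℂ)) atTop (𝓝 (inner ℂ h (z m)))) :
    Tendsto (fun n => (inner ℂ (k n) (w n) : ℂ)) atTop (𝓝 (inner ℂ h y)) := by
  have hC0 : 0 ≤ C := (norm_nonneg _).trans (hk 0)
  have h1 : Tendsto (fun n => (inner ℂ (k n) y : ℂ)) atTop (𝓝 (inner ℂ h y)) := by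
    rw [Metric.tendsto_atTop]
    intro ε hε
    -- Replacing y by z m costs at most (C + ‖h‖)‖z m - y‖ ≤ ε/2.
    have hδ : 0 < ε / (2 * (C + ‖h‖ + 1)) := by positivity
    obtain ⟨m, hm⟩ := ((Metric.tendsto_atTop.1 hz) _ hδ)
    have hm := hm m le_rfl
    obtain ⟨N, hN⟩ := (Metric.tendsto_atTop.1 (hkz m)) (ε / 2) (by positivity)
    refine ⟨N, fun n hn => ?_⟩
    have h2 := hN n hn
    rw [dist_eq_norm] at h2 hm ⊢
    have e1 : (inner ℂ (k n) y : ℂ) - inner ℂ h y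
        = (inner ℂ (k n) (z m) - inner ℂ h (z m)) - inner ℂ (k n - h) (z m - y) := by
      simp only [inner_sub_left, inner_sub_right]; ring
    have e2 : ‖(inner ℂ (k n - h) (z m - y) : ℂ)‖ ≤ (C + ‖h‖) * ‖z m - y‖ :=
      (norm_inner_le_norm _ _).trans (mul_le_mul_of_nonneg_right
        ((norm_sub_le _ _).trans (add_le_add (hk n) le_rfl)) (norm_nonneg _))
    have e3 : (C + ‖h‖) * ‖z m - y‖ ≤ ε / 2 := by
      rw [lt_div_iff₀ (by positivity)] at hm
      nlinarith [norm_nonneg (z m - y), norm_nonneg h]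
    rw [e1]
    refine (norm_sub_le _ _).trans_lt ?_
    linarith
  have h2 : Tendsto (fun n => (inner ℂ (k n) (w n - y) : ℂ)) atTop (𝓝 0) := by
    have h3 : Tendsto (fun n => C * ‖w n - y‖) atTop (𝓝 0) := by
      simpa using (tendsto_iff_norm_sub_tendsto_zero.1 hw).const_mul C
    exact squeeze_zero_norm (fun n => (norm_inner_le_norm _ _).trans
      (mul_le_mul_of_nonneg_right (hk n) (norm_nonneg _))) h3
  have h3 := h2.add h1
  rw [zero_add] at h3
  refine h3.congr fun n => ?_
  rw [← inner_add_right, sub_add_cancel]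

/-- Against smoothed vectors, the derivative moves onto the other factor as a bounded multiplier;
`L²` convergence of f then yields weak convergence of g. -/
lemma IsFreqMul.inner_smoothing {i : Fin d} {f g : L2 d} (h : IsFreqMul i f g) (m : ℕ) (y : L2 d) :
    inner ℂ g (smoothing m y) = inner ℂ f
      (SatNLS.mulOp (fun ξ => (starRingEnd ℂ) (I * freq i ξ * cutoff m ξ)) y) := by
  rw [← inner_smoothing_left, ← h.smoothedDeriv, SatNLS.smoothedDeriv,
    inner_mulOp_left (bddMeas_freq_mul_cutoff i m)]

lemma tendsto_energyRate (a : ℝ) {f : L2 d} {D : Fin d → L2 d}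
    (hD : ∀ i, IsFreqMul i (𝓕 f) (D i)) :
    Tendsto (fun n => energyRate a n f) atTop (𝓝 0) := by
  choose K hK using exists_isFreqMul_satL2_mollify hD
  have hH : ∀ i, ∃ g, IsFreqMul i (𝓕 (satL2 f)) g ∧ ‖g‖ ≤ 3 * ‖D i‖ := fun i =>
    (hD i).exists_satL2
  choose H hH using hH
  have hx : Tendsto (fun n => (𝓕 (satL2 (mollify n f)) : L2 d)) atTop (𝓝 (𝓕 (satL2 f))) :=
    ((continuous_fourier_L2.comp continuous_satL2).tendsto f).comp (tendsto_mollify f)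
  have hs : ∀ g : L2 d, Tendsto (fun n => smoothing n g) atTop (𝓝 g) := fun g =>
    tendsto_smoothing tendsto_const_nhds
  have h1 : ∀ i, Tendsto (fun n => (inner ℂ (smoothing n (D i)) (smoothing n (H i)) : ℂ)) atTop
      (𝓝 (inner ℂ (D i) (H i))) := fun i => (hs _).inner (hs _)
  -- The gradients K n i are bounded by 3‖D i‖ and are only shown to converge weakly; that suffices,
  -- as the other factor converges strongly.
  have h2 : ∀ i, Tendsto (fun n => (inner ℂ (smoothing n (K n i)) (smoothing n (D i)) : ℂ)) atTop
      (𝓝 (inner ℂ (H i) (D i))) := by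
    intro i
    simp only [inner_smoothing_left]
    refine tendsto_inner_of_weak (fun n => (hK n i).2) (hs (D i)) (tendsto_smoothing (hs (D i)))
      fun m => ?_
    simp only [(hK _ i).1.inner_smoothing, (hH i).1.inner_smoothing]
    exact hx.inner tendsto_const_nhds
  have h3 : Tendsto (fun n => (inner ℂ (𝓕 (satL2 (mollify n f)) : L2 d)
      (smoothing n (smoothing n (𝓕 (satL2 f)))) : ℂ)) atTop
      (𝓝 (inner ℂ (𝓕 (satL2 f) : L2 d) (𝓕 (satL2 f)))) :=
    hx.inner (tendsto_smoothing (hs _))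
  have h4 := tendsto_finsetSum Finset.univ fun i _ => (h1 i).add (h2 i)
  have h5 := ((continuous_re.tendsto _).comp (h4.const_mul I)).const_mul (2 * a)
  have h6 := ((continuous_re.tendsto _).comp (h3.const_mul I)).const_mul (2 * a ^ 2)
  have h7 := h5.sub h6
  have e1 : (I * ∑ i, ((inner ℂ (D i) (H i) : ℂ) + inner ℂ (H i) (D i))).re = 0 := by
    rw [I_mul_re, im_sum, neg_eq_zero]
    refine Finset.sum_eq_zero fun i _ => ?_
    rw [← inner_conj_symm (H i) (D i), add_im, conj_im, add_neg_cancel]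
  have e2 : (I * (inner ℂ (𝓕 (satL2 f) : L2 d) (𝓕 (satL2 f)) : ℂ)).re = 0 := by
    rw [I_mul_re, neg_eq_zero]
    exact inner_self_im (𝕜 := ℂ) (𝓕 (satL2 f) : L2 d)
  rw [e1, e2, mul_zero, mul_zero, sub_zero] at h7
  refine h7.congr fun n => ?_
  rw [energyRate_eq hD (fun i => (hH i).1) (fun i => (hK n i).1)]
  rfl

lemma tendsto_regularEnergy (a : ℝ) {f : L2 d} {D : Fin d → L2 d}
    (hD : ∀ i, IsFreqMul i (𝓕 f) (D i)) :
    Tendsto (fun n => regularEnergy a n f) atTop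
      (𝓝 (∑ i, ‖D i‖ ^ 2 - a * potentialEnergy f)) := by
  unfold regularEnergy
  refine (tendsto_finsetSum _ fun i _ => ?_).sub
    (((continuous_potentialEnergy.tendsto f).comp (tendsto_mollify f)).const_mul a)
  simp only [(hD i).smoothedDeriv]
  exact (tendsto_smoothing tendsto_const_nhds).norm.pow 2

/-- Conservation of the energy, in terms of the Fourier side gradient. -/
theorem IsSolution.energy_eq {a : ℝ} (ha : |a| = 1) {A : ℝ → L2 d} (hA : IsSolution a A)
    {D : Fin d → ℝ → L2 d} (hD : ∀ i t, IsFreqMul i (𝓕 (A t)) (D i t)) {C : Fin d → ℝ}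
    (hC : ∀ i t, ‖D i t‖ ≤ C i * Real.exp (3 * |t|)) (t : ℝ) :
    ∑ i, ‖D i t‖ ^ 2 - a * potentialEnergy (A t)
      = ∑ i, ‖D i 0‖ ^ 2 - a * potentialEnergy (A 0) := by
  have hc : ∀ n, Continuous fun s => energyRate a n (A s) := fun n =>
    (continuous_energyRate a n).comp hA.1
  have h1 : ∀ n, ∫ s in (0 : ℝ)..t, energyRate a n (A s)
      = regularEnergy a n (A t) - regularEnergy a n (A 0) := fun n =>
    intervalIntegral.integral_eq_sub_of_hasDerivAt
      (fun s _ => hA.hasDerivAt_regularEnergy n s) ((hc n).intervalIntegrable _ _)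
  -- Dominated convergence in time: the rate tends to 0 at each s, under the `H¹` and mass bounds.
  have h2 : Tendsto (fun n => ∫ s in (0 : ℝ)..t, energyRate a n (A s)) atTop
      (𝓝 (∫ s in (0 : ℝ)..t, (0 : ℝ))) := by
    refine intervalIntegral.tendsto_integral_filter_of_dominated_convergence
      (fun s => 12 * ∑ i, (C i * Real.exp (3 * |s|)) ^ 2 + 2 * ‖A 0‖ ^ 2)
      (Eventually.of_forall fun n => (hc n).aestronglyMeasurable)
      (Eventually.of_forall fun n => Eventually.of_forall fun s _ => ?_) ?_
      (Eventually.of_forall fun s _ => tendsto_energyRate a fun i => hD i s)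
    · refine (abs_energyRate_le ha n fun i => hD i s).trans ?_
      rw [hA.norm_eq s]
      gcongr with i
      exact hC i s
    · exact Continuous.intervalIntegrable (by fun_prop) _ _
  simp only [h1, intervalIntegral.integral_zero] at h2
  have h3 := (tendsto_regularEnergy a fun i => hD i t).sub (tendsto_regularEnergy a fun i => hD i 0)
  exact sub_eq_zero.1 (tendsto_nhds_unique h3 h2)

/-! ### Continuity in `H¹` and the energy identity -/

/-- Continuity in time of the Fourier side gradient. -/
theorem IsSolution.continuous_isFreqMul {a : ℝ} (ha : |a| = 1) {A : ℝ → L2 d}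
    (hA : IsSolution a A) {i : Fin d} {D : ℝ → L2 d} (hD : ∀ t, IsFreqMul i (𝓕 (A t)) (D t))
    {C : ℝ} (hC : ∀ t, ‖D t‖ ≤ C * Real.exp (3 * |t|)) : Continuous D := by
  have hC0 : 0 ≤ C := by
    have := (norm_nonneg _).trans (hC 0)
    simpa using this
  have hder : ∀ n t, HasDerivAt (fun t => smoothing n (propagator t (D t)))
      (smoothedDeriv n i (profileField a t (propagator t (𝓕 (A t))))) t := by
    intro n t
    have h := hasDerivAt_complexCLM_comp (smoothedDeriv n i)
      (hA.hasDerivAt_profile t)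
    refine h.congr_of_eventuallyEq (Eventually.of_forall fun s => ?_)
    change smoothing n (propagator s (D s)) = smoothedDeriv n i (propagator s (𝓕 (A s)))
    rw [smoothedDeriv_propagator, (hD s).smoothedDeriv, smoothing_propagator]
  have hbd : ∀ n t, ‖smoothedDeriv n i (profileField a t (propagator t (𝓕 (A t))))‖
      ≤ 3 * (C * Real.exp (3 * |t|)) := by
    intro n t
    obtain ⟨g, hg, hg2⟩ := (hD t).exists_satL2
    rw [profileField_profile, map_smul, smoothedDeriv_propagator, hg.smoothedDeriv, norm_smul,
      norm_propagator, norm_mul, norm_I, Complex.norm_real, Real.norm_eq_abs, ha, one_mul, one_mul]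
    have := hC t
    linarith [norm_smoothing_le n g]
  -- The derivative bound does not depend on n, so the Lipschitz estimate for the regularized
  -- gradient profiles passes to the limit.
  have hlip : ∀ R s t, s ∈ Set.Icc (-R) R → t ∈ Set.Icc (-R) R →
      ‖propagator t (D t) - propagator s (D s)‖ ≤ 3 * (C * Real.exp (3 * R)) * ‖t - s‖ := by
    intro R s t hs ht
    have h1 : ∀ n, ‖smoothing n (propagator t (D t)) - smoothing n (propagator s (D s))‖
        ≤ 3 * (C * Real.exp (3 * R)) * ‖t - s‖ := fun n =>
      (convex_Icc (-R) R).norm_image_sub_le_of_norm_hasDerivWithin_le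
        (fun x _ => (hder n x).hasDerivWithinAt)
        (fun x hx => (hbd n x).trans (by
          have := abs_le.2 hx
          gcongr)) hs ht
    have h3 : ∀ g : L2 d, Tendsto (fun n => smoothing n g) atTop (𝓝 g) := fun g =>
      tendsto_smoothing tendsto_const_nhds
    have h2 : Tendsto (fun n => ‖smoothing n (propagator t (D t))
        - smoothing n (propagator s (D s))‖) atTop
        (𝓝 ‖propagator t (D t) - propagator s (D s)‖) :=
      ((h3 _).sub (h3 _)).norm
    exact le_of_tendsto' h2 h1
  have hW : Continuous fun t => propagator t (D t) := by
    refine continuous_iff_continuousAt.2 fun t => ?_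
    have hmem : Set.Icc (-(|t| + 1)) (|t| + 1) ∈ 𝓝 t :=
      Icc_mem_nhds (by linarith [neg_abs_le t]) (by linarith [le_abs_self t])
    have ht : t ∈ Set.Icc (-(|t| + 1)) (|t| + 1) := mem_of_mem_nhds hmem
    refine tendsto_iff_norm_sub_tendsto_zero.2 (squeeze_zero' (Eventually.of_forall fun s =>
      norm_nonneg _) (by filter_upwards [hmem] with s hs using hlip _ t s ht hs) ?_)
    exact Continuous.tendsto' (by fun_prop) _ _ (by simp)
  have h := continuous_propagator.comp (continuous_neg.prodMk hW)
  refine h.congr fun t => ?_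
  exact propagator_neg_propagator t (D t)

end SatNLS
end

noncomputable section

namespace SatNLS

open FourierTransform Filter Topology

variable {d : ℕ}

lemma integrable_energyDensity (a : ℝ) (u : H1 d) : Integrable (energyDensity a u) :=
  (integrable_finsetSum _ fun i _ => integrable_norm_sq (H1grad u i)).add
    ((integrable_log (H1fn u)).const_mul a)

/-- Here ln(1+|A|²) = |A|² - Γ(A); the extra mass term is conserved separately. -/
lemma integral_energyDensity (a : ℝ) (u : H1 d) :
    ∫ x, energyDensity a u x = ∑ i, ‖(𝓕 (H1grad u i) : L2 d)‖ ^ 2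
      - a * potentialEnergy (H1fn u) + a * ‖H1fn u‖ ^ 2 := by
  have h1 : ∫ x, energyDensity a u x
      = ∫ x, (∑ i, ‖H1grad u i x‖ ^ 2) + a * Real.log (1 + ‖H1fn u x‖ ^ 2) := rfl
  rw [h1, integral_add (integrable_finsetSum _ fun i _ => integrable_norm_sq (H1grad u i))
    ((integrable_log (H1fn u)).const_mul a),
    integral_finsetSum _ fun i _ => integrable_norm_sq (H1grad u i), integral_const_mul,
    potentialEnergy_eq]
  simp only [Lp.norm_fourier_eq, norm_sq_eq_integral]
  ring

lemma isFreqMul_H1grad (u : H1 d) (i : Fin d) : IsFreqMul i (𝓕 (H1fn u)) (𝓕 (H1grad u i)) :=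
  (toDist_eq_lineDeriv_iff i _ _).1 (u.2 i)

/-- Solutions with `H¹` data are continuous in `H¹` and conserve the energy. -/
theorem IsSolution.exists_continuous_H1 {a : ℝ} (ha : |a| = 1) {A : ℝ → L2 d}
    (hA : IsSolution a A) (u₀ : H1 d) (h0 : A 0 = H1fn u₀) :
    ∃ u : ℝ → H1 d, Continuous u ∧ (∀ t : ℝ, H1fn (u t) = A t) ∧
      ∀ t : ℝ, Integrable (energyDensity a (u t)) ∧
        ∫ x, energyDensity a (u t) x = ∫ x, energyDensity a u₀ x := by
  have hg₀ : ∀ i, IsFreqMul i (𝓕 (A 0)) (𝓕 (H1grad u₀ i)) := fun i => by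
    rw [h0]; exact isFreqMul_H1grad u₀ i
  choose D hD hC using fun i => hA.exists_isFreqMul ha (hg₀ i)
  have hDc : ∀ i, Continuous (D i) := fun i => hA.continuous_isFreqMul ha (hD i) (hC i)
  let u : ℝ → H1 d := fun t => ⟨(A t, fun i => 𝓕⁻ (D i t)), fun i =>
    (toDist_eq_lineDeriv_iff i _ _).2 (by
      rw [fourier_fourierInv_eq]
      exact hD i t)⟩
  refine ⟨u, ?_, fun t => rfl, fun t => ⟨integrable_energyDensity a (u t), ?_⟩⟩
  · exact Continuous.subtype_mk (hA.1.prodMk (continuous_pi fun i =>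
      continuous_fourierInv_L2.comp (hDc i))) _
  · have h1 : ∀ i, (𝓕 (H1grad (u t) i) : L2 d) = D i t := fun i => fourier_fourierInv_eq _
    -- The chosen gradient at time 0 is the given one, since the symbol determines it.
    have h2 : ∀ i, D i 0 = 𝓕 (H1grad u₀ i) := fun i => (hD i 0).unique (hg₀ i)
    have h3 := hA.energy_eq ha hD hC t
    have h4 : H1fn (u t) = A t := rfl
    rw [integral_energyDensity, integral_energyDensity, h4, hA.norm_eq t, ← h0]
    simp only [h1, ← h2, h3]

end SatNLS

end

theorem theorem1 (d : ℕ) (a : ℝ) (ha : a = 1 ∨ a = -1) :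
    -- existence and uniqueness in `C(ℝ; L²)`
    (∀ A₀ : SatNLS.L2 d, ∃! A : ℝ → SatNLS.L2 d, SatNLS.IsSolution a A ∧ A 0 = A₀) ∧
    -- continuous dependence on the data in `L²`, uniformly on compact time intervals
    (∀ (A₀ : SatNLS.L2 d) (T ε : ℝ), 0 < T → 0 < ε → ∃ δ : ℝ, 0 < δ ∧
      ∀ A B : ℝ → SatNLS.L2 d, SatNLS.IsSolution a A → SatNLS.IsSolution a B →
        A 0 = A₀ → ‖B 0 - A₀‖ < δ → ∀ t : ℝ, |t| ≤ T → ‖B t - A t‖ < ε) ∧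
    -- conservation of the `L²` norm
    (∀ A : ℝ → SatNLS.L2 d, SatNLS.IsSolution a A →
      ∀ t : ℝ, ∫ x, ‖A t x‖ ^ 2 = ∫ x, ‖A 0 x‖ ^ 2) ∧
    -- for `H¹` data the solution is in `C(ℝ; H¹)` and conserves the energy
    (∀ (u₀ : SatNLS.H1 d) (A : ℝ → SatNLS.L2 d), SatNLS.IsSolution a A → A 0 = SatNLS.H1fn u₀ →
      ∃ u : ℝ → SatNLS.H1 d, Continuous u ∧ (∀ t : ℝ, SatNLS.H1fn (u t) = A t) ∧
        ∀ t : ℝ, Integrable (SatNLS.energyDensity a (u t)) ∧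
          ∫ x, SatNLS.energyDensity a (u t) x = ∫ x, SatNLS.energyDensity a u₀ x) := by
  have ha' : |a| = 1 := by rcases ha with rfl | rfl <;> simp
  refine ⟨fun A₀ => ?_, fun A₀ T ε hT hε => ?_, fun A hA t => ?_, fun u₀ A hA h0 => ?_⟩
  · obtain ⟨A, hA, hA0⟩ := SatNLS.exists_isSolution ha' A₀
    exact ⟨A, ⟨hA, hA0⟩, fun B hB => hB.1.eq ha' hA (hB.2.trans hA0.symm)⟩
  -- On [-T, T] the flow has Lipschitz constant at most e^{3T}, where 3 is the Lipschitz constant of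
  -- the nonlinearity.
  · refine ⟨ε / Real.exp (3 * T), by positivity, fun A B hA hB hA0 hB0 t ht => ?_⟩
    have h1 := hB.norm_sub_le ha' hA t
    rw [hA0] at h1
    rw [lt_div_iff₀ (Real.exp_pos _)] at hB0
    refine h1.trans_lt (lt_of_le_of_lt ?_ hB0)
    gcongr
  · rw [← SatNLS.norm_sq_eq_integral, ← SatNLS.norm_sq_eq_integral, hA.norm_eq t]
  · exact hA.exists_continuous_H1 ha' u₀ h0
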